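/- Let $G$ be a compact quantum group, given by its Hopf $*$-algebra $(\mathbb C[G],\Delta)$ of regular functions (a Hopf $*$-algebra with a faithful positive Haar state $h$), and let $C(G)$ be its reduced C$^*$-algebra, that is, the norm closure of $\mathbb C[G]$ in the GNS-representation of $h$. A unital Yetter--Drinfeld $G$-C$^*$-algebra is a nonzero unital C$^*$-algebra $A$ with * a continuous left action of $G$: an injective unital $*$-homomorphism $\alpha\colon A\to C(G)\otimes A$ (minimal tensor product) with $(\Delta\otimes\iota)\alpha=(\iota\otimes\alpha)\alpha$ and satisfying the Podleś condition; equivalently, the set $\mathcal A$ of regular elements, i.e. of those $a\in A$ for which $\alpha(a)$ lies in the algebraic tensor product $\mathbb C[G]\otimes_{\rm alg}A$, is dense in $A$, and coassociativity holds on $\mathcal A$; * a right action of the dual discrete quantum group $\hat G$, i.e. a left $\mathbb C[G]$-module algebra structure $x\rhd a$ on $A$ with $x\rhd a^*=(S(x)^*\rhd a)^*$; such that the Yetter--Drinfeld condition $\alpha(x\rhd a)=x_{(1)}a_{(1)}S(x_{(3)})\otimes(x_{(2)}\rhd a_{(2)})$ holds for all $x\in\mathbb C[G]$ and $a\in\mathcal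 A$, where $\alpha(a)=a_{(1)}\otimes a_{(2)}$. Equivalently, $A$ carries an action of the Drinfeld double $D(G)$. A unital completely positive (ucp) map $\phi\colon A\to B$ between such algebras is $D(G)$-equivariant if it is a $\mathbb C[G]$-module map and $\alpha_B(\phi(a))=(\iota\otimes\phi)\alpha_A(a)$ for all $a\in\mathcal A$. Isomorphisms are $D(G)$-equivariant $*$-isomorphisms. A unital Yetter--Drinfeld $G$-C$^*$-algebra $A$ is a $D(G)$-boundary if every $D(G)$-equivariant ucp map from $A$ to a unital Yetter--Drinfeld $G$-C$^*$-algebra is completely isometric. It is $D(G)$-injective if, for all unital Yetter--Drinfeld $G$-C$^*$-algebras $B$, $C$, every completely isometric $D(G)$-equivariant ucp map $\phi\colon B\to C$ and every $D(G)$-equivariant ucp map $\psi\colon B\to A$, there is a $D(G)$-equivariant ucp map $\tilde\psi\colon C\to A$ with $\tilde\psi\phi=\psi$. Let $C(\partial_{\rm FH}D(G))$ be the Furstenberg--Hamana boundary of $D(G)$, that is, a $D(G)$-boundary that is $D(G)$-injective (such a boundary is unique up to isomorphism). A unital Yetter--Drinfeld $G$-C$^*$-subalgebra of it is a closed unital $*$-subalgebra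 that is a Yetter--Drinfeld $G$-C$^*$-algebra for the restrictions of the two actions. Theorem. A unital Yetter--Drinfeld $G$-C$^*$-algebra is a $D(G)$-boundary if and only if it is isomorphic to a unital Yetter--Drinfeld $G$-C$^*$-subalgebra of $C(\partial_{\rm FH}D(G))$. Furthermore, let $A_1,A_2\subset C(\partial_{\rm FH}D(G))$ be two such subalgebras. If $A_1\subset A_2$, then the embedding $A_1\hookrightarrow A_2$ is the only $D(G)$-equivariant ucp map $A_1\to A_2$. If $A_1\not\subset A_2$, then there are no $D(G)$-equivariant ucp maps $A_1\to A_2$. -/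

import Mathlib

open scoped TensorProduct ComplexOrder InnerProductSpace

universe u

noncomputable section

/-! ### Minimal tensor product of unital C⋆-algebras -/

section HilbertTensor

variable (H K : Type u) [NormedAddCommGroup H] [InnerProductSpace ℂ H]
  [NormedAddCommGroup K] [InnerProductSpace ℂ K]

/-- The Hilbert space tensor product. -/
def HilbertTensor : Type u := UniformSpace.Completion (H ⊗[ℂ] K)

instance : NormedAddCommGroup (HilbertTensor H K) :=
  inferInstanceAs (NormedAddCommGroup (UniformSpace.Completion (H ⊗[ℂ] K)))
instance : InnerProductSpace ℂ (HilbertTensor H K) :=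
  inferInstanceAs (InnerProductSpace ℂ (UniformSpace.Completion (H ⊗[ℂ] K)))
instance : CompleteSpace (HilbertTensor H K) :=
  inferInstanceAs (CompleteSpace (UniformSpace.Completion (H ⊗[ℂ] K)))

variable {H K}

/-- The elementary tensor `x ⊗ y` in the Hilbert space tensor product. -/
def HilbertTensor.tmul (x : H) (y : K) : HilbertTensor H K :=
  ((x ⊗ₜ[ℂ] y : H ⊗[ℂ] K) : UniformSpace.Completion (H ⊗[ℂ] K))

/-- The bounded operator `f ⊗ g` on the Hilbert space tensor product. -/
def HilbertTensor.map (f : H →L[ℂ] H) (g : K →L[ℂ] K) :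
    HilbertTensor H K →L[ℂ] HilbertTensor H K :=
  (TensorProduct.mapL f g).completion

theorem HilbertTensor.map_tmul (f : H →L[ℂ] H) (g : K →L[ℂ] K) (x : H) (y : K) :
    HilbertTensor.map f g (HilbertTensor.tmul x y) = HilbertTensor.tmul (f x) (g y) := by
  exact ContinuousLinearMap.completion_apply_coe _ _

theorem HilbertTensor.inner_tmul (x x' : H) (y y' : K) :
    ⟪HilbertTensor.tmul x y, HilbertTensor.tmul x' y'⟫_ℂ = ⟪x, x'⟫_ℂ * ⟪y, y'⟫_ℂ :=
  (UniformSpace.Completion.inner_coe _ _).trans (TensorProduct.inner_tmul (𝕜 := ℂ) ..)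

theorem HilbertTensor.induction {P : HilbertTensor H K → Prop} (z : HilbertTensor H K)
    (hc : IsClosed {z | P z}) (ht : ∀ x y, P (HilbertTensor.tmul x y))
    (ha : ∀ z w, P z → P w → P (z + w)) : P z := by
  refine UniformSpace.Completion.induction_on (p := P) z hc fun t => ?_
  induction t with
  | zero =>
    have := ht 0 0
    simpa [HilbertTensor.tmul] using this
  | tmul x y => exact ht x y
  | add s t hs ht =>
    have := ha _ _ hs ht
    rwa [UniformSpace.Completion.coe_add]

theorem HilbertTensor.ext {S T : HilbertTensor H K →L[ℂ] HilbertTensor H K}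
    (h : ∀ x y, S (HilbertTensor.tmul x y) = T (HilbertTensor.tmul x y)) : S = T := by
  ext z
  refine HilbertTensor.induction (P := fun z => S z = T z) z
    (isClosed_eq S.continuous T.continuous) h fun z w hz hw => ?_
  simp only [map_add, hz, hw]

theorem HilbertTensor.map_mul (f f' : H →L[ℂ] H) (g g' : K →L[ℂ] K) :
    HilbertTensor.map (f * f') (g * g') = HilbertTensor.map f g * HilbertTensor.map f' g' :=
  HilbertTensor.ext fun x y => by
    simp only [mul_apply_eq_comp, HilbertTensor.map_tmul]

theorem HilbertTensor.map_one_one :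
    HilbertTensor.map (1 : H →L[ℂ] H) (1 : K →L[ℂ] K) = 1 :=
  HilbertTensor.ext fun x y => by simp [HilbertTensor.map_tmul]

theorem HilbertTensor.add_tmul (x x' : H) (y : K) :
    HilbertTensor.tmul (x + x') y = HilbertTensor.tmul x y + HilbertTensor.tmul x' y := by
  simp only [HilbertTensor.tmul, TensorProduct.add_tmul]
  exact UniformSpace.Completion.coe_add _ _

theorem HilbertTensor.tmul_add (x : H) (y y' : K) :
    HilbertTensor.tmul x (y + y') = HilbertTensor.tmul x y + HilbertTensor.tmul x y' := by
  simp only [HilbertTensor.tmul, TensorProduct.tmul_add]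
  exact UniformSpace.Completion.coe_add _ _

theorem HilbertTensor.smul_tmul (c : ℂ) (x : H) (y : K) :
    HilbertTensor.tmul (c • x) y = c • HilbertTensor.tmul x y := by
  simp only [HilbertTensor.tmul, ← TensorProduct.smul_tmul']
  exact UniformSpace.Completion.coe_smul _ _

theorem HilbertTensor.tmul_smul (c : ℂ) (x : H) (y : K) :
    HilbertTensor.tmul x (c • y) = c • HilbertTensor.tmul x y := by
  simp only [HilbertTensor.tmul, TensorProduct.tmul_smul]
  exact UniformSpace.Completion.coe_smul _ _

theorem HilbertTensor.star_map [CompleteSpace H] [CompleteSpace K]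
    (f : H →L[ℂ] H) (g : K →L[ℂ] K) :
    HilbertTensor.map (star f) (star g) = star (HilbertTensor.map f g) := by
  rw [ContinuousLinearMap.star_eq_adjoint (HilbertTensor.map f g),
    ContinuousLinearMap.eq_adjoint_iff]
  intro z w
  refine HilbertTensor.induction
    (P := fun z => ⟪HilbertTensor.map (star f) (star g) z, w⟫_ℂ = ⟪z, HilbertTensor.map f g w⟫_ℂ)
    z (isClosed_eq (by fun_prop) (by fun_prop)) (fun x y => ?_) fun z z' hz hz' => ?_
  · refine HilbertTensor.induction (P := fun w =>
      ⟪HilbertTensor.map (star f) (star g) (HilbertTensor.tmul x y), w⟫_ℂ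
        = ⟪HilbertTensor.tmul x y, HilbertTensor.map f g w⟫_ℂ)
      w (isClosed_eq (by fun_prop) (by fun_prop)) (fun x' y' => ?_) fun w w' hw hw' => ?_
    · simp only [HilbertTensor.map_tmul, HilbertTensor.inner_tmul,
        ContinuousLinearMap.star_eq_adjoint, ContinuousLinearMap.adjoint_inner_left]
    · simp only [map_add, inner_add_right, hw, hw']
  · simp only [map_add, inner_add_left, hz, hz']

variable (H K) in
/-- The `⋆`-homomorphism `f ↦ f ⊗ 1`. -/
def HilbertTensor.ampLeft [CompleteSpace H] [CompleteSpace K] :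
    (H →L[ℂ] H) →⋆ₐ[ℂ] (HilbertTensor H K →L[ℂ] HilbertTensor H K) where
  toFun f := HilbertTensor.map f 1
  map_one' := HilbertTensor.map_one_one
  map_mul' f g := by
    rw [← HilbertTensor.map_mul, one_mul]
  map_zero' := HilbertTensor.ext fun x y => by
    have := HilbertTensor.smul_tmul 0 x y
    simpa [HilbertTensor.map_tmul] using this
  map_add' f g := HilbertTensor.ext fun x y => by
    simp [HilbertTensor.map_tmul, HilbertTensor.add_tmul]
  commutes' c := HilbertTensor.ext fun x y => by
    simp [HilbertTensor.map_tmul, HilbertTensor.smul_tmul, Algebra.algebraMap_eq_smul_one]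
  map_star' f := by
    rw [← HilbertTensor.star_map, star_one]

variable (H K) in
/-- The `⋆`-homomorphism `g ↦ 1 ⊗ g`. -/
def HilbertTensor.ampRight [CompleteSpace H] [CompleteSpace K] :
    (K →L[ℂ] K) →⋆ₐ[ℂ] (HilbertTensor H K →L[ℂ] HilbertTensor H K) where
  toFun f := HilbertTensor.map 1 f
  map_one' := HilbertTensor.map_one_one
  map_mul' f g := by
    rw [← HilbertTensor.map_mul, one_mul]
  map_zero' := HilbertTensor.ext fun x y => by
    have := HilbertTensor.tmul_smul 0 x y
    simpa [HilbertTensor.map_tmul] using this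
  map_add' f g := HilbertTensor.ext fun x y => by
    simp [HilbertTensor.map_tmul, HilbertTensor.tmul_add]
  commutes' c := HilbertTensor.ext fun x y => by
    simp [HilbertTensor.map_tmul, HilbertTensor.tmul_smul, Algebra.algebraMap_eq_smul_one]
  map_star' f := by
    rw [← HilbertTensor.star_map, star_one]

end HilbertTensor

/-- A unital `⋆`-representation of `A` on a Hilbert space. -/
structure HilbertRep (A : Type u) [CStarAlgebra A] : Type (u + 1) where
  space : Type u
  [normedAddCommGroup : NormedAddCommGroup space]
  [innerProductSpace : InnerProductSpace ℂ space]
  [completeSpace : CompleteSpace space]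
  hom : A →⋆ₐ[ℂ] (space →L[ℂ] space)

attribute [instance] HilbertRep.normedAddCommGroup HilbertRep.innerProductSpace
  HilbertRep.completeSpace

section MinTensor

variable {A B : Type u} [CStarAlgebra A] [CStarAlgebra B]

/-- The representation `a ↦ ρ(a) ⊗ 1`. -/
def HilbertRep.left (ρ : HilbertRep A) (σ : HilbertRep B) :
    A →⋆ₐ[ℂ] (HilbertTensor ρ.space σ.space →L[ℂ] HilbertTensor ρ.space σ.space) :=
  (HilbertTensor.ampLeft ρ.space σ.space).comp ρ.hom

/-- The representation `b ↦ 1 ⊗ σ(b)`. -/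
def HilbertRep.right (ρ : HilbertRep A) (σ : HilbertRep B) :
    B →⋆ₐ[ℂ] (HilbertTensor ρ.space σ.space →L[ℂ] HilbertTensor ρ.space σ.space) :=
  (HilbertTensor.ampRight ρ.space σ.space).comp σ.hom

theorem HilbertRep.left_mul_right (ρ : HilbertRep A) (σ : HilbertRep B) (a : A) (b : B) :
    ρ.left σ a * ρ.right σ b = HilbertTensor.map (ρ.hom a) (σ.hom b) :=
  HilbertTensor.ext fun x y => by
    simp [HilbertRep.left, HilbertRep.right, HilbertTensor.ampLeft, HilbertTensor.ampRight,
      HilbertTensor.map_tmul]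

theorem HilbertRep.right_mul_left (ρ : HilbertRep A) (σ : HilbertRep B) (a : A) (b : B) :
    ρ.right σ b * ρ.left σ a = HilbertTensor.map (ρ.hom a) (σ.hom b) :=
  HilbertTensor.ext fun x y => by
    simp [HilbertRep.left, HilbertRep.right, HilbertTensor.ampLeft, HilbertTensor.ampRight,
      HilbertTensor.map_tmul]

/-- The representation `ρ ⊗ σ` of the algebraic tensor product `A ⊗ B`, characterized by
`(ρ ⊗ σ)(a ⊗ b) = ρ(a) ⊗ σ(b)`. -/
def HilbertRep.tensor (ρ : HilbertRep A) (σ : HilbertRep B) :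
    A ⊗[ℂ] B →ₐ[ℂ] (HilbertTensor ρ.space σ.space →L[ℂ] HilbertTensor ρ.space σ.space) :=
  Algebra.TensorProduct.lift (ρ.left σ).toAlgHom (ρ.right σ).toAlgHom fun a b =>
    (ρ.left_mul_right σ a b).trans (ρ.right_mul_left σ a b).symm

theorem HilbertRep.tensor_tmul (ρ : HilbertRep A) (σ : HilbertRep B) (a : A) (b : B) :
    ρ.tensor σ (a ⊗ₜ[ℂ] b) = HilbertTensor.map (ρ.hom a) (σ.hom b) :=
  (Algebra.TensorProduct.lift_tmul _ _ _ a b).trans (ρ.left_mul_right σ a b)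

theorem HilbertRep.tensor_star (ρ : HilbertRep A) (σ : HilbertRep B) (t : A ⊗[ℂ] B) :
    ρ.tensor σ (star t) = star (ρ.tensor σ t) := by
  induction t with
  | zero => simp
  | add s t hs ht => simp [hs, ht]
  | tmul a b => simp [HilbertRep.tensor_tmul, map_star, HilbertTensor.star_map]

theorem HilbertRep.exists_norm_tensor_le (t : A ⊗[ℂ] B) :
    ∃ C : ℝ, ∀ p : HilbertRep A × HilbertRep B, ‖p.1.tensor p.2 t‖ ≤ C := by
  induction t with
  | zero => exact ⟨0, fun p => by simp⟩
  | add s t hs ht =>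
    obtain ⟨C, hC⟩ := hs
    obtain ⟨D, hD⟩ := ht
    exact ⟨C + D, fun p => by
      rw [map_add]; exact (norm_add_le _ _).trans (add_le_add (hC p) (hD p))⟩
  | tmul a b =>
    refine ⟨‖a‖ * ‖b‖, fun p => ?_⟩
    rw [HilbertRep.tensor_tmul, ← HilbertRep.left_mul_right]
    exact (norm_mul_le _ _).trans (mul_le_mul (NonUnitalStarAlgHom.norm_apply_le (p.1.left p.2) a)
      (NonUnitalStarAlgHom.norm_apply_le (p.1.right p.2) b) (norm_nonneg _) (norm_nonneg _))

/-- The minimal (spatial) norm on the algebraic tensor product: the supremum of the norms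
`‖(ρ ⊗ σ)(t)‖` over all pairs of representations. -/
def minNorm (t : A ⊗[ℂ] B) : ℝ :=
  ⨆ p : HilbertRep A × HilbertRep B, ‖p.1.tensor p.2 t‖

theorem norm_tensor_le_minNorm (t : A ⊗[ℂ] B) (p : HilbertRep A × HilbertRep B) :
    ‖p.1.tensor p.2 t‖ ≤ minNorm t := by
  obtain ⟨C, hC⟩ := HilbertRep.exists_norm_tensor_le t
  exact le_ciSup (f := fun p : HilbertRep A × HilbertRep B => ‖p.1.tensor p.2 t‖)
    ⟨C, by rintro _ ⟨q, rfl⟩; exact hC q⟩ p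

theorem minNorm_nonneg (t : A ⊗[ℂ] B) : 0 ≤ minNorm t :=
  Real.iSup_nonneg fun _ => norm_nonneg _

theorem minNorm_star (t : A ⊗[ℂ] B) : minNorm (star t) = minNorm t := by
  simp only [minNorm, HilbertRep.tensor_star, norm_star]

theorem minNorm_mul_self_le (t : A ⊗[ℂ] B) : minNorm t * minNorm t ≤ minNorm (star t * t) := by
  have h : minNorm t ≤ √(minNorm (star t * t)) :=
    Real.iSup_le (fun p => Real.le_sqrt_of_sq_le (by
      rw [sq, ← CStarRing.norm_star_mul_self, ← HilbertRep.tensor_star, ← map_mul]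
      exact norm_tensor_le_minNorm _ p)) (Real.sqrt_nonneg _)
  calc _ ≤ √(minNorm (star t * t)) * √(minNorm (star t * t)) :=
        mul_self_le_mul_self (minNorm_nonneg t) h
    _ = _ := Real.mul_self_sqrt (minNorm_nonneg _)

variable (A B) in
/-- The algebraic tensor product, to be equipped with the minimal norm. -/
def PreMinTensor : Type u := A ⊗[ℂ] B

instance : Ring (PreMinTensor A B) := inferInstanceAs (Ring (A ⊗[ℂ] B))
instance : Algebra ℂ (PreMinTensor A B) := inferInstanceAs (Algebra ℂ (A ⊗[ℂ] B))
instance : StarRing (PreMinTensor A B) := inferInstanceAs (StarRing (A ⊗[ℂ] B))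
instance : StarModule ℂ (PreMinTensor A B) := inferInstanceAs (StarModule ℂ (A ⊗[ℂ] B))
instance : Norm (PreMinTensor A B) := ⟨fun t => minNorm (A := A) (B := B) t⟩

theorem PreMinTensor.core : SeminormedSpace.Core ℂ (PreMinTensor A B) where
  norm_nonneg := minNorm_nonneg
  norm_smul c t := by
    show minNorm (A := A) (B := B) (c • (show A ⊗[ℂ] B from t)) = ‖c‖ * minNorm _
    unfold minNorm
    rw [Real.mul_iSup_of_nonneg (norm_nonneg c)]
    exact iSup_congr fun p => by rw [map_smul, norm_smul]
  norm_triangle s t :=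
    Real.iSup_le (fun p => by
      show ‖p.1.tensor p.2 ((show A ⊗[ℂ] B from s) + (show A ⊗[ℂ] B from t))‖ ≤ _
      rw [map_add]
      exact (norm_add_le _ _).trans
        (add_le_add (norm_tensor_le_minNorm s p) (norm_tensor_le_minNorm t p)))
      (add_nonneg (minNorm_nonneg _) (minNorm_nonneg _))

instance : SeminormedRing (PreMinTensor A B) :=
  { SeminormedAddCommGroup.ofCore PreMinTensor.core,
    (inferInstance : Ring (PreMinTensor A B)) with
    norm_mul_le := fun s t =>
      Real.iSup_le (fun p => by
        show ‖p.1.tensor p.2 ((show A ⊗[ℂ] B from s) * (show A ⊗[ℂ] B from t))‖ ≤ _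
        rw [map_mul]
        exact (norm_mul_le _ _).trans (mul_le_mul (norm_tensor_le_minNorm s p)
          (norm_tensor_le_minNorm t p) (norm_nonneg _) (minNorm_nonneg _)))
        (mul_nonneg (minNorm_nonneg _) (minNorm_nonneg _)) }

instance : NormedAlgebra ℂ (PreMinTensor A B) where
  norm_smul_le c t := (PreMinTensor.core.norm_smul c t).le

instance : NormedStarGroup (PreMinTensor A B) where
  norm_star_le t := (minNorm_star (A := A) (B := B) t).le

variable (A B) in
/-- The minimal tensor product of two unital C⋆-algebras: the completion of the algebraic tensor
product in the minimal norm. -/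
def MinTensor : Type u := UniformSpace.Completion (PreMinTensor A B)

instance : NormedRing (MinTensor A B) :=
  inferInstanceAs (NormedRing (UniformSpace.Completion (PreMinTensor A B)))
instance : CompleteSpace (MinTensor A B) :=
  inferInstanceAs (CompleteSpace (UniformSpace.Completion (PreMinTensor A B)))
instance : Algebra ℂ (MinTensor A B) :=
  inferInstanceAs (Algebra ℂ (UniformSpace.Completion (PreMinTensor A B)))

instance : NormedAlgebra ℂ (MinTensor A B) where
  norm_smul_le c x := by
    refine UniformSpace.Completion.induction_on
      (p := fun x : MinTensor A B => ‖c • x‖ ≤ ‖c‖ * ‖x‖) x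
      (isClosed_le ?_ (continuous_const.mul continuous_norm)) fun t => ?_
    · have h : (fun x : MinTensor A B => c • x) = fun x => algebraMap ℂ _ c * x :=
        funext fun x => Algebra.smul_def c x
      have hc : Continuous fun x : MinTensor A B => c • x := by
        rw [h]; exact continuous_const.mul continuous_id
      exact hc.norm
    · have h : c • (t : UniformSpace.Completion (PreMinTensor A B))
          = ((c • t : PreMinTensor A B) : UniformSpace.Completion (PreMinTensor A B)) :=
        (UniformSpace.Completion.coe_smul c t).symm
      refine (congrArg norm h).le.trans ?_
      refine (UniformSpace.Completion.norm_coe (c • t)).le.trans ?_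
      refine (norm_smul_le c t).trans (le_of_eq ?_)
      exact congrArg (‖c‖ * ·) (UniformSpace.Completion.norm_coe t).symm

/-- The canonical map from the algebraic tensor product. -/
def MinTensor.of (t : A ⊗[ℂ] B) : MinTensor A B :=
  ((show PreMinTensor A B from t) : UniformSpace.Completion (PreMinTensor A B))

theorem MinTensor.norm_of (t : A ⊗[ℂ] B) : ‖MinTensor.of t‖ = minNorm t :=
  UniformSpace.Completion.norm_coe (show PreMinTensor A B from t)

theorem MinTensor.of_mul (s t : A ⊗[ℂ] B) :
    MinTensor.of (s * t) = MinTensor.of s * MinTensor.of t :=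
  UniformSpace.Completion.coe_mul (show PreMinTensor A B from s) (show PreMinTensor A B from t)

theorem MinTensor.of_add (s t : A ⊗[ℂ] B) :
    MinTensor.of (s + t) = MinTensor.of s + MinTensor.of t :=
  UniformSpace.Completion.coe_add (show PreMinTensor A B from s) (show PreMinTensor A B from t)

theorem MinTensor.of_smul (c : ℂ) (t : A ⊗[ℂ] B) :
    MinTensor.of (c • t) = c • MinTensor.of t :=
  UniformSpace.Completion.coe_smul c (show PreMinTensor A B from t)

theorem MinTensor.induction {P : MinTensor A B → Prop} (x : MinTensor A B)
    (hc : IsClosed {x | P x}) (h : ∀ t, P (MinTensor.of t)) : P x :=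
  UniformSpace.Completion.induction_on x hc h

instance : Star (MinTensor A B) :=
  ⟨UniformSpace.Completion.map (star : PreMinTensor A B → PreMinTensor A B)⟩

theorem MinTensor.continuous_star : Continuous (star : MinTensor A B → MinTensor A B) :=
  UniformSpace.Completion.continuous_map

theorem MinTensor.of_star (t : A ⊗[ℂ] B) : MinTensor.of (star t) = star (MinTensor.of t) :=
  (UniformSpace.Completion.map_coe
    (star_isometry (E := PreMinTensor A B)).uniformContinuous
    (show PreMinTensor A B from t)).symm

instance : StarRing (MinTensor A B) where
  star_involutive x := by
    refine MinTensor.induction (P := fun x => star (star x) = x) x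
      (isClosed_eq (MinTensor.continuous_star.comp MinTensor.continuous_star) continuous_id)
      fun t => ?_
    rw [← MinTensor.of_star, ← MinTensor.of_star, star_star]
  star_mul x y := by
    refine MinTensor.induction (P := fun x => star (x * y) = star y * star x) x
      (isClosed_eq (MinTensor.continuous_star.comp (continuous_id.mul continuous_const))
        (continuous_const.mul MinTensor.continuous_star)) fun s => ?_
    refine MinTensor.induction
      (P := fun y => star (MinTensor.of s * y) = star y * star (MinTensor.of s)) y
      (isClosed_eq (MinTensor.continuous_star.comp (continuous_const.mul continuous_id))
        (MinTensor.continuous_star.mul continuous_const)) fun t => ?_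
    simp only [← MinTensor.of_star, ← MinTensor.of_mul, star_mul]
  star_add x y := by
    refine MinTensor.induction (P := fun x => star (x + y) = star x + star y) x
      (isClosed_eq (MinTensor.continuous_star.comp (continuous_id.add continuous_const))
        (MinTensor.continuous_star.add continuous_const)) fun s => ?_
    refine MinTensor.induction
      (P := fun y => star (MinTensor.of s + y) = star (MinTensor.of s) + star y) y
      (isClosed_eq (MinTensor.continuous_star.comp (continuous_const.add continuous_id))
        (continuous_const.add MinTensor.continuous_star)) fun t => ?_
    simp only [← MinTensor.of_star, ← MinTensor.of_add, star_add]

instance : StarModule ℂ (MinTensor A B) where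
  star_smul c x := by
    refine MinTensor.induction (P := fun x => star (c • x) = star c • star x) x
      (isClosed_eq (MinTensor.continuous_star.comp (continuous_const_smul c))
        ((continuous_const_smul _).comp MinTensor.continuous_star)) fun t => ?_
    simp only [← MinTensor.of_star, ← MinTensor.of_smul, star_smul]

instance : CStarRing (MinTensor A B) where
  norm_mul_self_le x := by
    refine MinTensor.induction (P := fun x => ‖x‖ * ‖x‖ ≤ ‖star x * x‖) x
      (isClosed_le (continuous_norm.mul continuous_norm)
        (MinTensor.continuous_star.mul continuous_id).norm) fun t => ?_
    rw [← MinTensor.of_star, ← MinTensor.of_mul, MinTensor.norm_of, MinTensor.norm_of]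
    exact minNorm_mul_self_le t

instance : CStarAlgebra (MinTensor A B) where

variable (A B) in
/-- The canonical `⋆`-homomorphism from the algebraic to the minimal tensor product. -/
def MinTensor.ofHom : A ⊗[ℂ] B →⋆ₐ[ℂ] MinTensor A B where
  toFun := MinTensor.of
  map_one' := rfl
  map_mul' := MinTensor.of_mul
  map_zero' := rfl
  map_add' := MinTensor.of_add
  commutes' _ := rfl
  map_star' := MinTensor.of_star

end MinTensor

/-! ### Compact quantum groups in the reduced form -/

/-- A compact quantum group `G`, given by the Hopf `⋆`-algebra `O = ℂ[G]` of regular functions: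
a Hopf `⋆`-algebra that has a faithful positive Haar state. -/
class CompactQuantumGroup (O : Type u) [Ring O] [StarRing O] [HopfAlgebra ℂ O]
    [StarModule ℂ O] where
  comul_star : ∀ x : O, Coalgebra.comul (R := ℂ) (star x) = star (Coalgebra.comul (R := ℂ) x)
  haar : O →ₗ[ℂ] ℂ
  haar_one : haar 1 = 1
  /-- `(h ⊗ ι)Δ(x) = h(x)1` -/
  haar_left : ∀ x : O, TensorProduct.lid ℂ O (haar.rTensor O (Coalgebra.comul x)) = haar x • 1
  /-- `(ι ⊗ h)Δ(x) = h(x)1` -/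
  haar_right : ∀ x : O, TensorProduct.rid ℂ O (haar.lTensor O (Coalgebra.comul x)) = haar x • 1
  haar_pos : ∀ x : O, x ≠ 0 → 0 < haar (star x * x)

section Reduced

open CompactQuantumGroup

variable (O : Type u) [Ring O] [StarRing O] [HopfAlgebra ℂ O] [StarModule ℂ O]
  [CompactQuantumGroup O]

variable {O} in
theorem CompactQuantumGroup.haar_nonneg (x : O) : 0 ≤ haar (star x * x) := by
  rcases eq_or_ne x 0 with rfl | h
  · simp
  · exact (haar_pos x h).le

variable {O} in
theorem CompactQuantumGroup.haar_star (x : O) : haar (star x) = star (haar x) := by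
  have him : ∀ y : O, (haar (star y * y)).im = 0 := fun y =>
    (Complex.le_def.1 (haar_nonneg y)).2.symm
  have h0 := him x
  have h1 := him (1 + x)
  have h2 := him (1 + Complex.I • x)
  simp only [star_add, star_one, star_smul, add_mul, mul_add, one_mul, mul_one, map_add,
    smul_mul_assoc, mul_smul_comm, map_smul, haar_one, Complex.add_im, smul_eq_mul] at h1 h2
  simp at h1 h2
  apply Complex.ext
  · simp; linarith
  · simp; linarith

/-- `ℂ[G]` with the inner product `⟨x, y⟩ = h(x⋆ y)`. -/
def PreL2 : Type u := O

instance : AddCommGroup (PreL2 O) := inferInstanceAs (AddCommGroup O)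
instance : Module ℂ (PreL2 O) := inferInstanceAs (Module ℂ O)

/-- The identity map. -/
def toPreL2 : O ≃ₗ[ℂ] PreL2 O := LinearEquiv.refl ℂ O

instance PreL2.core : InnerProductSpace.Core ℂ (PreL2 O) where
  inner x y := haar (star ((toPreL2 O).symm x) * (toPreL2 O).symm y)
  conj_inner_symm x y := by
    rw [← Complex.star_def, ← haar_star]; simp
  re_inner_nonneg x := (Complex.le_def.1 (haar_nonneg ((toPreL2 O).symm x))).1
  add_left x y z := by simp [add_mul]
  smul_left x y c := by simp
  definite x hx := by
    by_contra h
    exact (haar_pos ((toPreL2 O).symm x) (by simpa using h)).ne' hx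

instance : NormedAddCommGroup (PreL2 O) := (PreL2.core O).toNormedAddCommGroup
instance : InnerProductSpace ℂ (PreL2 O) := InnerProductSpace.ofCore (PreL2.core O).toCore

theorem PreL2.inner_def (x y : O) :
    ⟪toPreL2 O x, toPreL2 O y⟫_ℂ = haar (star x * y) := rfl

/-- The GNS space `L²(G)` of the Haar state. -/
abbrev L2 : Type u := UniformSpace.Completion (PreL2 O)

variable {O} in
/-- Left multiplication by a regular function is bounded on the GNS space. -/
theorem CompactQuantumGroup.exists_bound (x : O) :
    ∃ C : ℝ, ∀ y : O, ‖toPreL2 O (x * y)‖ ≤ C * ‖toPreL2 O y‖ := by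
  classical
  obtain ⟨V, hV, hx⟩ := TensorProduct.exists_finite_submodule_left_of_setFinite
    (R := ℂ) (M := PreL2 O) (N := O)
    {(toPreL2 O).toLinearMap.rTensor O (Coalgebra.comul (R := ℂ) x)} (Set.finite_singleton _)
  obtain ⟨t, ht⟩ := hx (Set.mem_singleton _)
  have : FiniteDimensional ℂ V := hV
  let e := stdOrthonormalBasis ℂ V
  obtain ⟨c, hc⟩ := TensorProduct.eq_repr_basis_left e.toBasis t
  let v : Fin (Module.finrank ℂ V) → O := fun i => (toPreL2 O).symm (e i : PreL2 O)
  have hcomul : Coalgebra.comul (R := ℂ) x = ∑ i, v i ⊗ₜ[ℂ] c i := by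
    have h1 : (toPreL2 O).symm.toLinearMap.rTensor O
        ((toPreL2 O).toLinearMap.rTensor O (Coalgebra.comul (R := ℂ) x))
        = Coalgebra.comul (R := ℂ) x := by
      rw [← LinearMap.comp_apply, ← LinearMap.rTensor_comp]
      simp
    rw [← h1, ← ht, ← hc, Finsupp.sum_fintype _ _ (by simp)]
    simp [v]
  have horth : ∀ i j, haar (star (v i) * v j) = if i = j then 1 else 0 := by
    intro i j
    have h := orthonormal_iff_ite.1 e.orthonormal i j
    rw [← h]
    rfl
  have hsum : ∑ i, star (c i) * c i = haar (star x * x) • (1 : O) := by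
    rw [← haar_left, Bialgebra.comul_mul, comul_star, hcomul]
    simp only [star_sum, TensorProduct.star_tmul, Finset.sum_mul_sum,
      Algebra.TensorProduct.tmul_mul_tmul, map_sum, LinearMap.rTensor_tmul,
      TensorProduct.lid_tmul, horth, ite_smul, one_smul, zero_smul]
    simp
  have hbd : ∀ i, ∀ y : O, ‖toPreL2 O (c i * y)‖ ^ 2
      ≤ (haar (star x * x)).re * ‖toPreL2 O y‖ ^ 2 := by
    intro i y
    have hn : ∀ z : O, ‖toPreL2 O z‖ ^ 2 = (haar (star z * z)).re := fun z => by
      rw [← PreL2.inner_def, ← inner_self_eq_norm_sq (𝕜 := ℂ)]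
      rfl
    have h1 : ∑ j, (haar (star (c j * y) * (c j * y))).re
        = (haar (star x * x)).re * (haar (star y * y)).re := by
      rw [← Complex.re_sum, ← map_sum]
      have h2 : ∑ j, star (c j * y) * (c j * y) = haar (star x * x) • (star y * y) := by
        have h3 : ∑ j, star (c j * y) * (c j * y) = star y * (∑ j, star (c j) * c j) * y := by
          simp only [Finset.mul_sum, Finset.sum_mul, star_mul, mul_assoc]
        rw [h3, hsum]
        simp
      rw [h2, map_smul, smul_eq_mul, Complex.mul_re]
      have him : (haar (star x * x)).im = 0 := (Complex.le_def.1 (haar_nonneg x)).2.symm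
      rw [him]; ring
    rw [hn, hn, ← h1]
    exact Finset.single_le_sum (f := fun j => (haar (star (c j * y) * (c j * y))).re)
      (fun j _ => (Complex.le_def.1 (haar_nonneg (c j * y))).1) (Finset.mem_univ i)
  have hexp : x = ∑ i, Coalgebra.counit (R := ℂ) (v i) • c i := by
    have h := Coalgebra.rTensor_counit_comul (R := ℂ) x
    rw [hcomul] at h
    have h2 := congrArg (TensorProduct.lid ℂ O) h
    simpa using h2.symm
  refine ⟨∑ i, ‖Coalgebra.counit (R := ℂ) (v i)‖ * √(haar (star x * x)).re, fun y => ?_⟩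
  have hxy : toPreL2 O (x * y)
      = ∑ i, Coalgebra.counit (R := ℂ) (v i) • toPreL2 O (c i * y) := by
    conv_lhs => rw [hexp]
    simp [Finset.sum_mul]
  rw [hxy, Finset.sum_mul]
  refine (norm_sum_le _ _).trans (Finset.sum_le_sum fun i _ => ?_)
  rw [norm_smul, mul_assoc]
  refine mul_le_mul_of_nonneg_left ?_ (norm_nonneg _)
  have hre : 0 ≤ (haar (star x * x)).re := (Complex.le_def.1 (haar_nonneg x)).1
  refine le_of_sq_le_sq ?_ (by positivity)
  rw [mul_pow, Real.sq_sqrt hre]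
  exact hbd i y

/-- Left multiplication by `x` on the GNS space. -/
def leftMulPreL2 (x : O) : PreL2 O →L[ℂ] PreL2 O :=
  ((toPreL2 O).toLinearMap ∘ₗ LinearMap.mulLeft ℂ x ∘ₗ
    (toPreL2 O).symm.toLinearMap).mkContinuousOfExistsBound (by
      obtain ⟨C, hC⟩ := exists_bound x
      exact ⟨C, fun y => hC ((toPreL2 O).symm y)⟩)

theorem leftMulPreL2_apply (x y : O) :
    leftMulPreL2 O x (toPreL2 O y) = toPreL2 O (x * y) := rfl

/-- The GNS representation of `ℂ[G]` on `L²(G)` by left multiplication. -/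
def gnsRep : O →⋆ₐ[ℂ] (L2 O →L[ℂ] L2 O) where
  toFun x := (leftMulPreL2 O x).completion
  map_one' := by
    ext z
    refine UniformSpace.Completion.induction_on z
      (isClosed_eq (by fun_prop) (by fun_prop)) fun y => ?_
    obtain ⟨y, rfl⟩ := (toPreL2 O).surjective y
    simp [leftMulPreL2_apply]
  map_mul' a b := by
    ext z
    refine UniformSpace.Completion.induction_on z
      (isClosed_eq (by fun_prop) (by fun_prop)) fun y => ?_
    obtain ⟨y, rfl⟩ := (toPreL2 O).surjective y
    simp [leftMulPreL2_apply, mul_assoc]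
  map_zero' := by
    ext z
    refine UniformSpace.Completion.induction_on z
      (isClosed_eq (by fun_prop) (by fun_prop)) fun y => ?_
    obtain ⟨y, rfl⟩ := (toPreL2 O).surjective y
    simp [leftMulPreL2_apply]
  map_add' a b := by
    ext z
    refine UniformSpace.Completion.induction_on z
      (isClosed_eq (by fun_prop) (by fun_prop)) fun y => ?_
    obtain ⟨y, rfl⟩ := (toPreL2 O).surjective y
    simp [leftMulPreL2_apply, add_mul, UniformSpace.Completion.coe_add]
  commutes' c := by
    ext z
    refine UniformSpace.Completion.induction_on z
      (isClosed_eq (by fun_prop) (by fun_prop)) fun y => ?_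
    obtain ⟨y, rfl⟩ := (toPreL2 O).surjective y
    simp [leftMulPreL2_apply, Algebra.algebraMap_eq_smul_one, UniformSpace.Completion.coe_smul]
  map_star' a := by
    rw [ContinuousLinearMap.star_eq_adjoint, ContinuousLinearMap.eq_adjoint_iff]
    intro z w
    refine UniformSpace.Completion.induction_on₂ z w
      (isClosed_eq (by fun_prop) (by fun_prop)) fun x y => ?_
    obtain ⟨x, rfl⟩ := (toPreL2 O).surjective x
    obtain ⟨y, rfl⟩ := (toPreL2 O).surjective y
    simp [leftMulPreL2_apply, PreL2.inner_def, mul_assoc]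

/-- The reduced C⋆-algebra `C(G)`: the norm closure of `ℂ[G]` in the GNS representation of the
Haar state. -/
def ReducedCStar : StarSubalgebra ℂ (L2 O →L[ℂ] L2 O) := (gnsRep O).range.topologicalClosure

instance : IsClosed (ReducedCStar O : Set (L2 O →L[ℂ] L2 O)) :=
  StarSubalgebra.isClosed_topologicalClosure _

/-- The embedding `ℂ[G] → C(G)`. -/
def toReduced : O →⋆ₐ[ℂ] ReducedCStar O :=
  (gnsRep O).codRestrict _ fun x =>
    StarSubalgebra.le_topologicalClosure _ ⟨x, rfl⟩

end Reduced
/-! ### Actions of `G`, of its dual, and Yetter–Drinfeld algebras -/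

section Actions

open Coalgebra

variable (O : Type u) [Ring O] [StarRing O] [HopfAlgebra ℂ O] [StarModule ℂ O]
  [CompactQuantumGroup O]

/-- The embedding of the algebraic tensor product `ℂ[G] ⊗ A` into `C(G) ⊗ A`. -/
def regularEmb (A : Type u) [CStarAlgebra A] : O ⊗[ℂ] A →ₐ[ℂ] MinTensor (ReducedCStar O) A :=
  (MinTensor.ofHom (ReducedCStar O) A).toAlgHom.comp
    (Algebra.TensorProduct.map (toReduced O).toAlgHom (AlgHom.id ℂ A))

/-- A (continuous) left action of `G` on a unital C⋆-algebra `A`: an injective unital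
`⋆`-homomorphism `α : A → C(G) ⊗ A` with `(Δ ⊗ ι)α = (ι ⊗ α)α` that satisfies the Podleś
condition. An element `a` is regular if `α(a)` lies in the algebraic tensor product `ℂ[G] ⊗ A`.
The Podleś condition is stated as density of the regular elements, and coassociativity on this
dense subset, where both sides lie in `ℂ[G] ⊗ (C(G) ⊗ A)` with the first tensor product
algebraic. -/
structure QAction (A : Type u) [CStarAlgebra A] where
  coact : A →⋆ₐ[ℂ] MinTensor (ReducedCStar O) A
  coact_injective : Function.Injective coact
  dense_regular : Dense {a : A | ∃ t : O ⊗[ℂ] A, coact a = regularEmb O A t}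
  coassoc : ∀ (a : A) (t : O ⊗[ℂ] A), coact a = regularEmb O A t →
    (regularEmb O A).toLinearMap.lTensor O
        (TensorProduct.assoc ℂ O O A ((comul : O →ₗ[ℂ] O ⊗[ℂ] O).rTensor A t))
      = coact.toAlgHom.toLinearMap.lTensor O t

/-- A right action of the dual discrete quantum group on a unital C⋆-algebra `A`, in its algebraic
description: a left `ℂ[G]`-module algebra structure `x ▹ a = act x a` on `A` such that
`x ▹ a⋆ = (S(x)⋆ ▹ a)⋆`. -/
structure DualAction (A : Type u) [CStarAlgebra A] where
  act : O →ₐ[ℂ] Module.End ℂ A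
  /-- `x ▹ (ab) = (x₍₁₎ ▹ a)(x₍₂₎ ▹ b)` -/
  act_mul : ∀ (x : O) (a b : A), act x (a * b) =
    LinearMap.mul' ℂ A (TensorProduct.map (act.toLinearMap.flip a) (act.toLinearMap.flip b)
      (comul (R := ℂ) x))
  act_one : ∀ x : O, act x 1 = counit (R := ℂ) x • (1 : A)
  act_star : ∀ (x : O) (a : A),
    act x (star a) = star (act (star (HopfAlgebra.antipode ℂ x)) a)

variable {O} in
/-- The linear map `x₁ ⊗ (x₂ ⊗ x₃) ↦ (y ⊗ a ↦ x₁ y S(x₃) ⊗ (x₂ ▹ a))`. -/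
def DualAction.twist {A : Type u} [CStarAlgebra A] (β : DualAction O A) :
    O ⊗[ℂ] (O ⊗[ℂ] O) →ₗ[ℂ] (O ⊗[ℂ] A →ₗ[ℂ] O ⊗[ℂ] A) :=
  TensorProduct.homTensorHomMap (RingHom.id ℂ) O A O A ∘ₗ
    (TensorProduct.comm ℂ (Module.End ℂ A) (Module.End ℂ O)).toLinearMap ∘ₗ
    TensorProduct.map β.act.toLinearMap
      (TensorProduct.lift ((LinearMap.mul ℂ (Module.End ℂ O)).compl₁₂ (LinearMap.mul ℂ O)
        ((LinearMap.mul ℂ O).flip ∘ₗ HopfAlgebra.antipode ℂ))) ∘ₗ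
    (TensorProduct.leftComm ℂ O O O).toLinearMap

variable {O} in
theorem DualAction.twist_tmul {A : Type u} [CStarAlgebra A] (β : DualAction O A)
    (x₁ x₂ x₃ y : O) (a : A) :
    β.twist (x₁ ⊗ₜ (x₂ ⊗ₜ x₃)) (y ⊗ₜ a)
      = (x₁ * (y * HopfAlgebra.antipode ℂ x₃)) ⊗ₜ[ℂ] β.act x₂ a := by
  simp [DualAction.twist]

/-- A Yetter–Drinfeld `G`-C⋆-algebra structure on a unital C⋆-algebra, that is, an action of the
Drinfeld double `D(G)`. -/
structure YDStructure (A : Type u) [CStarAlgebra A] extends QAction O A, DualAction O A where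
  /-- The Yetter–Drinfeld condition
  `α(x ▹ a) = x₍₁₎ a₍₁₎ S(x₍₃₎) ⊗ (x₍₂₎ ▹ a₍₂₎)` for `x ∈ ℂ[G]` and regular `a`. -/
  yetterDrinfeld : ∀ (x : O) (a : A) (t : O ⊗[ℂ] A), coact a = regularEmb O A t →
    coact (act x a) =
      regularEmb O A (toDualAction.twist ((comul (R := ℂ)).lTensor O (comul (R := ℂ) x)) t)

end Actions

/-! ### Unital completely positive and completely isometric maps -/

section UCP

attribute [local instance] CStarAlgebra.spectralOrder CStarAlgebra.spectralOrderedRing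

variable {A B : Type u} [CStarAlgebra A] [CStarAlgebra B]

/-- Unital completely positive maps. -/
def IsUCP (φ : A →ₗ[ℂ] B) : Prop :=
  φ 1 = 1 ∧ ∃ ψ : CompletelyPositiveMap A B, ψ.toLinearMap = φ

/-- Completely isometric maps. -/
def IsCompletelyIsometric (φ : A →ₗ[ℂ] B) : Prop :=
  ∀ (n : ℕ) (M : CStarMatrix (Fin n) (Fin n) A), ‖M.map φ‖ = ‖M‖

end UCP

/-! ### Equivariant maps, boundaries, injectivity -/

section Boundaries

variable {O : Type u} [Ring O] [StarRing O] [HopfAlgebra ℂ O] [StarModule ℂ O]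
  [CompactQuantumGroup O]

/-- `D(G)`-equivariance of a linear map `φ`: it satisfies `αφ = (ι ⊗ φ)α` on regular elements
(`G`-equivariance) and is a `ℂ[G]`-module map (equivariance for the dual of `G`). -/
structure IsEquivariant {A B : Type u} [CStarAlgebra A] [CStarAlgebra B]
    (X : YDStructure O A) (Y : YDStructure O B) (φ : A →ₗ[ℂ] B) : Prop where
  coact : ∀ (a : A) (t : O ⊗[ℂ] A), X.coact a = regularEmb O A t →
    Y.coact (φ a) = regularEmb O B (φ.lTensor O t)
  act : ∀ (x : O) (a : A), φ (X.act x a) = Y.act x (φ a)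

variable (O) in
/-- A (nonzero) unital Yetter–Drinfeld `G`-C⋆-algebra. -/
structure YDAlgebra : Type (u + 1) where
  carrier : Type u
  [cstarAlgebra : CStarAlgebra carrier]
  [nontrivial : Nontrivial carrier]
  str : YDStructure O carrier

attribute [instance] YDAlgebra.cstarAlgebra YDAlgebra.nontrivial

instance : CoeSort (YDAlgebra O) (Type u) := ⟨YDAlgebra.carrier⟩

/-- `D(G)`-equivariant ucp maps between unital Yetter–Drinfeld `G`-C⋆-algebras. -/
def IsEquivariantUCP (A B : YDAlgebra O) (φ : A →ₗ[ℂ] B) : Prop :=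
  IsUCP φ ∧ IsEquivariant A.str B.str φ

/-- Isomorphism of Yetter–Drinfeld `G`-C⋆-algebras: a `D(G)`-equivariant `⋆`-isomorphism. -/
def YDAlgebra.IsIsomorphic (A B : YDAlgebra O) : Prop :=
  ∃ e : A ≃⋆ₐ[ℂ] B, IsEquivariant A.str B.str
    { toFun := e, map_add' := map_add e, map_smul' := map_smul e }

/-- `D(G)`-boundaries: every `D(G)`-equivariant ucp map out of `A` is completely isometric. -/
def IsBoundary (A : YDAlgebra O) : Prop :=
  ∀ (B : YDAlgebra O) (ψ : A →ₗ[ℂ] B), IsEquivariantUCP A B ψ → IsCompletelyIsometric ψ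

/-- `D(G)`-injectivity. -/
def IsDGInjective (A : YDAlgebra O) : Prop :=
  ∀ (B C : YDAlgebra O) (φ : B →ₗ[ℂ] C) (ψ : B →ₗ[ℂ] A),
    IsEquivariantUCP B C φ → IsCompletelyIsometric φ → IsEquivariantUCP B A ψ →
      ∃ ψ' : C →ₗ[ℂ] A, IsEquivariantUCP C A ψ' ∧ ψ' ∘ₗ φ = ψ

/-- Furstenberg–Hamana boundaries of `D(G)`: the `D(G)`-injective `D(G)`-boundaries. -/
def IsFurstenbergHamanaBoundary (F : YDAlgebra O) : Prop :=
  IsBoundary F ∧ IsDGInjective F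

/-- A unital Yetter–Drinfeld `G`-C⋆-subalgebra of `F`: a norm closed unital `⋆`-subalgebra which is
itself a Yetter–Drinfeld `G`-C⋆-algebra for the restrictions of the two actions on `F`; the last
condition says that the inclusion map is equivariant. -/
structure YDSubalgebra (F : YDAlgebra O) where
  toStarSubalgebra : StarSubalgebra ℂ F
  isClosed : IsClosed (toStarSubalgebra : Set F)
  str : YDStructure O toStarSubalgebra
  equivariant : IsEquivariant str F.str toStarSubalgebra.subtype.toAlgHom.toLinearMap

/-- The subalgebra as a Yetter–Drinfeld `G`-C⋆-algebra. -/
def YDSubalgebra.toYDAlgebra {F : YDAlgebra O} (S : YDSubalgebra F) : YDAlgebra O :=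
  haveI := S.isClosed
  { carrier := S.toStarSubalgebra
    str := S.str }

/-- The inclusion map between two subalgebras. -/
def YDSubalgebra.inclusion {F : YDAlgebra O} {S T : YDSubalgebra F}
    (h : S.toStarSubalgebra ≤ T.toStarSubalgebra) : S.toYDAlgebra →ₗ[ℂ] T.toYDAlgebra :=
  (StarSubalgebra.inclusion h).toAlgHom.toLinearMap

end Boundaries
end

/-!
This is Hamana's argument. Let `F` be the Furstenberg–Hamana boundary. Every equivariant ucp map
`φ : F → F` is the identity: the Cesàro means of the powers of `φ` are isometric as `F` is a
boundary, but they are small on `x - φ(x)`. Together with injectivity of `F` this shows that the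
inclusion is the only equivariant ucp map into `F` from a subalgebra, which gives the rigidity
statements and also that subalgebras of `F` are boundaries, since every algebra maps to `F`.

Conversely, a boundary `A` has an equivariant ucp map `ψ : A → F`, and it is completely
isometric. By M. Riesz' extension theorem and the GNS construction every representation `σ` of `A`
extends along `ψ`: there are a representation `τ` of `F` and an isometry `V` with
`τ(ψ(a)) V = V σ(a)`. Hence `ψ(a) ↦ a` extends to a `⋆`-homomorphism `π : C⋆(ψ(A)) → A`. It is
equivariant, and it is isometric because `C⋆(ψ(A))` is a subalgebra of `F` and hence a boundary. The
module action of `ℂ[G]` passes to the closure `C⋆(ψ(A))` because it is by continuous operators: the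
matrix coefficients of a unitary corepresentation `u` define a `⋆`-homomorphism `a ↦ (uᵢⱼ ▹ a)ᵢⱼ`,
and they span `ℂ[G]`.
-/

noncomputable section

section Order

theorem complex_smul_one_eq_algebraMap {D : Type*} [CStarAlgebra D] (r : ℝ) :
    (r : ℂ) • (1 : D) = algebraMap ℝ D r := by
  rw [Algebra.algebraMap_eq_smul_one, Complex.coe_smul]

variable {D E : Type*} [CStarAlgebra D] [PartialOrder D] [StarOrderedRing D]
  [CStarAlgebra E] [PartialOrder E] [StarOrderedRing E]

theorem star_mul_self_le_smul_one (x : D) :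
    star x * x ≤ ((‖x‖ ^ 2 : ℝ) : ℂ) • (1 : D) := by
  rw [complex_smul_one_eq_algebraMap]
  exact CStarAlgebra.star_mul_le_algebraMap_norm_sq

theorem norm_le_of_star_mul_self_le {b : D} {r : ℝ} (hr : 0 ≤ r)
    (h : star b * b ≤ ((r ^ 2 : ℝ) : ℂ) • (1 : D)) : ‖b‖ ≤ r := by
  rw [complex_smul_one_eq_algebraMap] at h
  have h_sq : ‖star b * b‖ ≤ r ^ 2 :=
    (CStarAlgebra.norm_le_iff_le_algebraMap _ (by positivity) (star_mul_self_nonneg b)).2 h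
  rw [CStarRing.norm_star_mul_self, ← sq] at h_sq
  exact le_of_sq_le_sq h_sq hr

theorem exists_eq_star_mul_self {x : D} (hx : 0 ≤ x) : ∃ y, x = star y * y :=
  CStarAlgebra.nonneg_iff_eq_star_mul_self.1 hx

theorem norm_le_of_schwarz {Φ : D →ₗ[ℂ] E} (h_one : Φ 1 = 1) (h_pos : ∀ x, 0 ≤ x → 0 ≤ Φ x)
    (h_schwarz : ∀ x, star (Φ x) * Φ x ≤ Φ (star x * x)) (x : D) : ‖Φ x‖ ≤ ‖x‖ := by
  refine norm_le_of_star_mul_self_le (norm_nonneg x) ((h_schwarz x).trans ?_)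
  simpa only [map_sub, map_smul, h_one, sub_nonneg] using
    h_pos _ (sub_nonneg.2 (star_mul_self_le_smul_one x))

/-- For self-adjoint `x`, positivity is the norm condition `‖‖x‖ - x‖ ≤ ‖x‖`. -/
theorem nonneg_of_map_nonneg_of_isometry {Φ : D →ₗ[ℂ] E} (h_one : Φ 1 = 1)
    (h_star : ∀ x, Φ (star x) = star (Φ x)) (h_norm : ∀ x, ‖Φ x‖ = ‖x‖) {x : D}
    (hx : 0 ≤ Φ x) : 0 ≤ x := by
  have h_inj : Function.Injective Φ := (AddMonoidHomClass.isometry_of_norm Φ h_norm).injective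
  have h_sa : IsSelfAdjoint x := h_inj ((h_star x).trans (IsSelfAdjoint.of_nonneg hx))
  rw [nonneg_iff_isSelfAdjoint_and_quasispectrumRestricts] at hx ⊢
  refine ⟨h_sa, (SpectrumRestricts.nnreal_iff_nnnorm (t := ‖x‖₊) h_sa le_rfl).2 ?_⟩
  have h_le := (SpectrumRestricts.nnreal_iff_nnnorm (t := ‖x‖₊) hx.1 (h_norm x).le).1 hx.2
  have h_map : algebraMap ℝ E ‖x‖ - Φ x = Φ (algebraMap ℝ D ‖x‖ - x) := by
    simp only [← complex_smul_one_eq_algebraMap, map_sub, map_smul, h_one]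
  rw [← NNReal.coe_le_coe] at h_le ⊢
  simpa only [coe_nnnorm, h_map, h_norm] using h_le

end Order

section BlockMatrices

open Matrix

variable {R m n : Type*} [Ring R] [StarRing R] [Fintype m] [DecidableEq m]

theorem conjTranspose_row_mul_row (M : Matrix m n R) :
    (fromCols (1 : Matrix m m R) M)ᴴ * fromCols (1 : Matrix m m R) M =
      fromBlocks 1 M Mᴴ (Mᴴ * M) := by
  simp [conjTranspose_fromCols_eq_fromRows_conjTranspose]

theorem conjTranspose_column_mul_fromBlocks_mul [Fintype n] [DecidableEq n] (P : Matrix m n R)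
    (Q : Matrix n n R) :
    (fromRows (-P) (1 : Matrix n n R))ᴴ *
      (fromBlocks (1 : Matrix m m R) P Pᴴ Q * fromRows (-P) (1 : Matrix n n R)) = Q - Pᴴ * P := by
  simp [conjTranspose_fromRows_eq_fromCols_conjTranspose, fromBlocks_mul_fromRows,
    fromCols_mul_fromRows, sub_eq_neg_add]

end BlockMatrices

section MatrixPositivity

attribute [local instance] CStarAlgebra.spectralOrder CStarAlgebra.spectralOrderedRing

open CStarMatrix

/-- The Gram matrix `(rᵢ⋆ rⱼ)` of a row `r`. -/
def rowGram {A n : Type*} [Mul A] [Star A] (r : n → A) : CStarMatrix n n A :=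
  ofMatrix (Matrix.of fun i j => star (r i) * r j)

theorem rowGram_apply {A n : Type*} [Mul A] [Star A] (r : n → A) (i j : n) :
    rowGram r i j = star (r i) * r j := rfl

variable {A m n : Type*} [CStarAlgebra A] [Fintype m] [Fintype n]

theorem rowGram_nonneg (r : n → A) : 0 ≤ rowGram r := by
  classical
  rcases isEmpty_or_nonempty n with h | ⟨⟨i₀⟩⟩
  · exact le_of_eq (CStarMatrix.ext fun i => isEmptyElim i)
  · let N : CStarMatrix n n A := ofMatrix (Matrix.of (Pi.single i₀ r))
    suffices h : rowGram r = star N * N from h ▸ star_mul_self_nonneg N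
    ext i j
    rw [mul_apply, Finset.sum_eq_single i₀ (fun k _ hk => by simp [N, hk]) (by simp)]
    simp [N, star_apply, rowGram_apply]

theorem conjTranspose_mul_self_nonneg (W : CStarMatrix m n A) : 0 ≤ W.conjTranspose * W := by
  have h : W.conjTranspose * W = ∑ l, rowGram (W l) := by
    ext i j
    rw [show (∑ l, rowGram (W l)) i j = ∑ l, rowGram (W l) i j from
      Matrix.sum_apply i j Finset.univ fun l => rowGram (W l)]
    simp only [mul_apply, conjTranspose_apply, rowGram_apply]
  rw [h]
  exact Finset.sum_nonneg fun l _ => rowGram_nonneg _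

theorem conjTranspose_mul_mul_nonneg {Z : CStarMatrix m m A} (hZ : 0 ≤ Z)
    (Y : CStarMatrix m n A) : 0 ≤ Y.conjTranspose * (Z * Y) := by
  classical
  obtain ⟨N, rfl⟩ := exists_eq_star_mul_self (D := CStarMatrix m m A) hZ
  refine (conjTranspose_mul_self_nonneg (N * Y)).trans_eq ?_
  calc (N * Y).conjTranspose * (N * Y)
      = Y.conjTranspose * star N * (N * Y) :=
        congrArg (· * (N * Y)) (Matrix.conjTranspose_mul (m := m) N Y)
    _ = Y.conjTranspose * (star N * (N * Y)) := Matrix.mul_assoc _ _ _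
    _ = Y.conjTranspose * (star N * N * Y) :=
        congrArg (Y.conjTranspose * ·) (Matrix.mul_assoc _ _ _).symm

theorem diagonal_entry_nonneg {Z : CStarMatrix n n A} (hZ : 0 ≤ Z) (i : n) : 0 ≤ Z i i := by
  classical
  obtain ⟨N, rfl⟩ := exists_eq_star_mul_self (D := CStarMatrix n n A) hZ
  rw [mul_apply]
  exact Finset.sum_nonneg fun k _ => star_mul_self_nonneg (N k i)

/-- Elements of `A` as `1 × 1` matrices. -/
def oneByOne : A →⋆ₙₐ[ℂ] CStarMatrix (Fin 1) (Fin 1) A :=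
  { toOneByOne (Fin 1) ℂ A with
    map_smul' := fun _ _ => rfl
    map_zero' := rfl }

theorem oneByOne_apply (a : A) (i j : Fin 1) : oneByOne a i j = a := rfl

theorem norm_oneByOne (a : A) : ‖oneByOne a‖ = ‖a‖ :=
  NonUnitalStarAlgHom.norm_map oneByOne (toOneByOne (Fin 1) ℂ A).injective a

end MatrixPositivity

section UCP

attribute [local instance] CStarAlgebra.spectralOrder CStarAlgebra.spectralOrderedRing

open CStarMatrix

variable {A B C : Type u} [CStarAlgebra A] [CStarAlgebra B] [CStarAlgebra C]

theorem isUCP_iff {φ : A →ₗ[ℂ] B} : IsUCP φ ↔ φ 1 = 1 ∧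
    ∀ (k : ℕ) (M : CStarMatrix (Fin k) (Fin k) A), 0 ≤ M → 0 ≤ M.map φ := by
  refine and_congr_right fun _ => ⟨?_, fun h => ⟨⟨φ, h⟩, rfl⟩⟩
  rintro ⟨ψ, rfl⟩
  exact ψ.map_cstarMatrix_nonneg'

theorem IsCompletelyIsometric.of_starAlgHom (φ : A →⋆ₐ[ℂ] B) (h : Function.Injective φ) :
    IsCompletelyIsometric φ.toAlgHom.toLinearMap := fun n M =>
  NonUnitalStarAlgHom.norm_map (mapₙₐ (n := Fin n) (φ : A →⋆ₙₐ[ℂ] B)) (map_injective h) M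

namespace IsUCP

variable {φ : A →ₗ[ℂ] B} {n : Type*}

theorem of_starAlgHom (φ : A →⋆ₐ[ℂ] B) : IsUCP φ.toAlgHom.toLinearMap :=
  isUCP_iff.2 ⟨map_one φ, CompletelyPositiveMapClass.map_cstarMatrix_nonneg' φ⟩

theorem comp {ψ : B →ₗ[ℂ] C} (hψ : IsUCP ψ) (hφ : IsUCP φ) : IsUCP (ψ ∘ₗ φ) :=
  isUCP_iff.2 ⟨by rw [LinearMap.comp_apply, hφ.1, hψ.1], fun k M hM =>
    (isUCP_iff.1 hψ).2 k _ ((isUCP_iff.1 hφ).2 k M hM)⟩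

theorem map_matrix_nonneg [Fintype n] (h : IsUCP φ) {M : CStarMatrix n n A} (hM : 0 ≤ M) :
    0 ≤ M.map φ := by
  obtain ⟨-, ψ, rfl⟩ := h
  exact ψ.map_cstarMatrix_nonneg M hM

theorem map_star (h : IsUCP φ) (a : A) : φ (star a) = star (φ a) := by
  have h_sa := IsSelfAdjoint.of_nonneg (h.map_matrix_nonneg (rowGram_nonneg ![1, a]))
  simpa [star_apply, rowGram_apply] using (congrArg (fun M => M 1 0) h_sa.star_eq).symm

theorem mapₗ_star (h : IsUCP φ) (M : CStarMatrix n n A) : mapₗ φ (star M) = star (mapₗ φ M) := by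
  ext i j
  exact h.map_star (M j i)

theorem mapₗ_one [DecidableEq n] (h : IsUCP φ) : mapₗ φ (1 : CStarMatrix n n A) = 1 :=
  Matrix.map_one φ (map_zero φ) h.1

variable [Fintype n]

/-- Compress the image of `[1 M]⋆[1 M] ≥ 0` by the column with entries `-φ(M)` and `1`. -/
theorem schwarz_matrix (h : IsUCP φ) (M : CStarMatrix n n A) :
    star (mapₗ φ M) * mapₗ φ M ≤ mapₗ φ (star M * M) := by
  classical
  have h_map : (Matrix.fromBlocks 1 M (star M) (star M * M)).map φ =
      Matrix.fromBlocks 1 (mapₗ φ M) (star (mapₗ φ M)) (mapₗ φ (star M * M)) :=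
    (Matrix.fromBlocks_map _ _ _ _ φ).trans <| congrArg₂
      (fun P Q => Matrix.fromBlocks P (mapₗ φ M) Q (mapₗ φ (star M * M)))
      h.mapₗ_one (h.mapₗ_star M)
  have h_pos := h.map_matrix_nonneg
    (conjTranspose_mul_self_nonneg (ofMatrix (Matrix.fromCols (1 : Matrix n n A) M)))
  have h_conj := conjTranspose_mul_mul_nonneg h_pos
    (ofMatrix (Matrix.fromRows (-mapₗ φ M) (1 : Matrix n n B)))
  rw [← sub_nonneg]
  refine h_conj.trans_eq ?_
  refine Eq.trans ?_ (conjTranspose_column_mul_fromBlocks_mul (mapₗ φ M) (mapₗ φ (star M * M)))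
  refine congrArg (fun Z : Matrix (n ⊕ n) (n ⊕ n) B =>
    (Matrix.fromRows (-mapₗ φ M) (1 : Matrix n n B)).conjTranspose *
      (Z * Matrix.fromRows (-mapₗ φ M) (1 : Matrix n n B))) (Eq.trans ?_ h_map)
  exact congrArg (fun Z : Matrix (n ⊕ n) (n ⊕ n) A => Z.map φ)
    (conjTranspose_row_mul_row (m := n) M)

theorem norm_matrix_le (h : IsUCP φ) (M : CStarMatrix n n A) : ‖mapₗ φ M‖ ≤ ‖M‖ := by
  classical
  exact norm_le_of_schwarz (D := CStarMatrix n n A) (E := CStarMatrix n n B) (Φ := mapₗ φ)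
    h.mapₗ_one (fun _ => h.map_matrix_nonneg) h.schwarz_matrix M

theorem schwarz (h : IsUCP φ) (a : A) : star (φ a) * φ a ≤ φ (star a * a) := by
  have h_pos := sub_nonneg.2 (h.schwarz_matrix (oneByOne a))
  rw [← sub_nonneg]
  simpa [mul_apply, star_apply, oneByOne_apply] using diagonal_entry_nonneg h_pos 0

theorem norm_le (h : IsUCP φ) (a : A) : ‖φ a‖ ≤ ‖a‖ := by
  rw [← norm_oneByOne, ← norm_oneByOne a]
  exact h.norm_matrix_le (oneByOne a)

theorem continuous (h : IsUCP φ) : Continuous φ :=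
  AddMonoidHomClass.continuous_of_bound φ 1 fun a => by simpa using h.norm_le a

end IsUCP

namespace IsCompletelyIsometric

variable {φ : A →ₗ[ℂ] B}

theorem norm_map (h : IsCompletelyIsometric φ) (a : A) : ‖φ a‖ = ‖a‖ := by
  rw [← norm_oneByOne, ← norm_oneByOne a]
  exact h 1 (oneByOne a)

theorem of_comp {ψ : B →ₗ[ℂ] C} (hψ : IsUCP ψ)
    (hφ : IsUCP φ) (h : IsCompletelyIsometric (ψ ∘ₗ φ)) : IsCompletelyIsometric φ := fun n M =>
  le_antisymm (hφ.norm_matrix_le M) ((h n M).symm.le.trans (hψ.norm_matrix_le (M.map φ)))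

theorem nonneg_of_map_nonneg (h : IsCompletelyIsometric φ) (hφ : IsUCP φ) {n : Type*} [Fintype n]
    {M : CStarMatrix n n A} (hM : 0 ≤ M.map φ) : 0 ≤ M := by
  let e := Fintype.equivFin n
  have h_fin : 0 ≤ reindexₐ ℂ A e M :=
    nonneg_of_map_nonneg_of_isometry (D := CStarMatrix (Fin _) (Fin _) A)
      (E := CStarMatrix (Fin _) (Fin _) B) (Φ := mapₗ φ) hφ.mapₗ_one hφ.mapₗ_star (h _)
      (map_nonneg (reindexₐ ℂ B e) hM)
  simpa using map_nonneg (reindexₐ ℂ A e).symm h_fin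

end IsCompletelyIsometric

theorem convex_setOf_isUCP : Convex ℝ {φ : A →ₗ[ℂ] B | IsUCP φ} := by
  intro φ hφ ψ hψ s t hs ht hst
  refine isUCP_iff.2 ⟨?_, fun k M hM => ?_⟩
  · rw [LinearMap.add_apply, LinearMap.smul_apply, LinearMap.smul_apply, hφ.1, hψ.1, ← add_smul,
      hst, one_smul]
  · exact add_nonneg (smul_nonneg hs (hφ.map_matrix_nonneg hM))
      (smul_nonneg ht (hψ.map_matrix_nonneg hM))

end UCP

theorem ext_of_re_eq {E : Type*} [AddCommGroup E] [Module ℂ E] {f g : E →ₗ[ℂ] ℂ}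
    (h : ∀ x, (f x).re = (g x).re) : f = g := by
  ext x
  exact Complex.ext (h x) (by simpa using h (Complex.I • x))

theorem ext_of_eqOn_coe {𝕜 E F : Type*} [NormedField 𝕜] [SeminormedAddCommGroup E]
    [NormedSpace 𝕜 E] [NormedAddCommGroup F] [NormedSpace 𝕜 F]
    {S T : UniformSpace.Completion E →L[𝕜] F} (h : ∀ x : E, S x = T x) : S = T :=
  DFunLike.coe_injective (UniformSpace.Completion.ext S.continuous T.continuous h)

theorem exists_linearIsometry_of_inner {𝕜 H H' : Type*} [RCLike 𝕜] [NormedAddCommGroup H]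
    [InnerProductSpace 𝕜 H] [NormedAddCommGroup H'] [InnerProductSpace 𝕜 H'] (V : H → H')
    (h : ∀ x y, ⟪V x, V y⟫_𝕜 = ⟪x, y⟫_𝕜) : ∃ W : H →ₗᵢ[𝕜] H', ∀ x, W x = V x := by
  let W : H →ₗ[𝕜] H' :=
    { toFun := V
      map_add' := fun x y => by
        rw [← sub_eq_zero, ← inner_self_eq_zero (𝕜 := 𝕜)]
        simp only [inner_sub_left, inner_sub_right, inner_add_left, inner_add_right, h]
        ring
      map_smul' := fun c x => by
        rw [← sub_eq_zero, ← inner_self_eq_zero (𝕜 := 𝕜)]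
        simp only [inner_sub_left, inner_sub_right, inner_smul_left, inner_smul_right, h,
          RingHom.id_apply]
        ring }
  exact ⟨W.isometryOfInner h, fun _ => rfl⟩

section Outer

variable {K B : Type*} [Ring B] [StarRing B] [Algebra ℂ B] [StarModule ℂ B]

/-- The finitely supported matrix `(f(k)⋆ g(l))`, sesquilinear in `(f, g)`. -/
def outer : (K →₀ B) →ₗ⋆[ℂ] (K →₀ B) →ₗ[ℂ] (K × K →₀ B) := by
  classical
  exact LinearMap.mk₂'ₛₗ (starRingEnd ℂ) (RingHom.id ℂ)
    (fun f g => Finsupp.onFinset (f.support ×ˢ g.support) (fun p => star (f p.1) * g p.2)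
      fun p hp => Finset.mem_product.2 ⟨Finsupp.mem_support_iff.2 fun h => hp (by simp [h]),
        Finsupp.mem_support_iff.2 fun h => hp (by simp [h])⟩)
    (fun _ _ _ => by ext; simp [add_mul]) (fun _ _ _ => by ext; simp)
    (fun _ _ _ => by ext; simp [mul_add]) (fun _ _ _ => by ext; simp)

theorem outer_apply (f g : K →₀ B) (p : K × K) : outer f g p = star (f p.1) * g p.2 := rfl

theorem outer_single_single (k l : K) (b c : B) :
    outer (Finsupp.single k b) (Finsupp.single l c) = Finsupp.single (k, l) (star b * c) := by
  classical
  ext p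
  simp only [outer_apply, Finsupp.single_apply, Prod.ext_iff]
  by_cases hk : k = p.1 <;> by_cases hl : l = p.2 <;> simp [hk, hl]

theorem outer_smul_left (b : B) (f g : K →₀ B) : outer (b • f) g = outer f (star b • g) := by
  ext p
  simp [outer_apply, mul_assoc]

end Outer

/-- A positive semidefinite functional on the finitely supported matrices over `B`, the datum of
the GNS construction with values indexed by `K`. -/
structure PositiveKernel (K B : Type*) [CStarAlgebra B] where
  toLinearMap : (K × K →₀ B) →ₗ[ℂ] ℂ
  re_nonneg : ∀ f : K →₀ B, 0 ≤ (toLinearMap (outer f f)).re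
  conj_symm : ∀ f g : K →₀ B, star (toLinearMap (outer g f)) = toLinearMap (outer f g)

namespace PositiveKernel

variable {K B : Type u} [CStarAlgebra B] (G : PositiveKernel K B)

/-- The functions `K →₀ B`, as a type carrying the inner product `⟪f, g⟫ = G (f⋆ g)`. -/
@[nolint unusedArguments]
def Pre (_ : PositiveKernel K B) : Type u := K →₀ B

instance : AddCommGroup G.Pre := inferInstanceAs (AddCommGroup (K →₀ B))
instance : Module ℂ G.Pre := inferInstanceAs (Module ℂ (K →₀ B))
instance : Module B G.Pre := inferInstanceAs (Module B (K →₀ B))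
instance : IsScalarTower ℂ B G.Pre := inferInstanceAs (IsScalarTower ℂ B (K →₀ B))

/-- The identity map onto `G.Pre`. -/
def toPre : (K →₀ B) ≃ₗ[B] G.Pre := LinearEquiv.refl B _

/-- The pre-inner product `⟪f, g⟫ = G (f⋆ g)`. -/
abbrev core : PreInnerProductSpace.Core ℂ G.Pre where
  inner f g := G.toLinearMap (outer (K := K) (B := B) f g)
  conj_inner_symm f g := G.conj_symm f g
  re_inner_nonneg f := G.re_nonneg f
  add_left f g h := (congrArg G.toLinearMap (outer.map_add₂ f g h)).trans (map_add _ _ _)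
  smul_left f g c := (congrArg G.toLinearMap (outer.map_smulₛₗ₂ c f g)).trans (map_smul _ _ _)

instance : SeminormedAddCommGroup G.Pre :=
  InnerProductSpace.Core.toSeminormedAddCommGroup (c := G.core)
instance : InnerProductSpace ℂ G.Pre := InnerProductSpace.ofCore G.core

theorem inner_toPre (f g : K →₀ B) : ⟪G.toPre f, G.toPre g⟫_ℂ = G.toLinearMap (outer f g) := rfl

theorem inner_smul_left_eq (b : B) (f g : G.Pre) : ⟪b • f, g⟫_ℂ = ⟪f, star b • g⟫_ℂ :=
  congrArg G.toLinearMap (outer_smul_left b f g)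

theorem norm_smul_le_mul (b : B) (f : G.Pre) : ‖b • f‖ ≤ ‖b‖ * ‖f‖ := by
  let _ := CStarAlgebra.spectralOrder B
  have := CStarAlgebra.spectralOrderedRing B
  obtain ⟨c, hc⟩ := exists_eq_star_mul_self (sub_nonneg.2 (star_mul_self_le_smul_one b))
  have h_sq (d : B) : ⟪f, (star d * d) • f⟫_ℂ = ((‖d • f‖ ^ 2 : ℝ) : ℂ) := by
    rw [mul_smul, ← inner_smul_left_eq, inner_self_eq_norm_sq_to_K, Complex.ofReal_pow]
    rfl
  have h_sum : ‖c • f‖ ^ 2 = ‖b‖ ^ 2 * ‖f‖ ^ 2 - ‖b • f‖ ^ 2 := by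
    rw [← Complex.ofReal_inj, ← h_sq, ← hc, sub_smul, inner_sub_right, h_sq, smul_assoc, one_smul,
      inner_smul_right, inner_self_eq_norm_sq_to_K]
    push_cast
    rfl
  refine le_of_sq_le_sq ?_ (by positivity)
  rw [mul_pow]
  linarith [sq_nonneg ‖c • f‖]

/-- Multiplication by `b` on the pre-Hilbert space. -/
def lsmulPre (b : B) : G.Pre →L[ℂ] G.Pre :=
  (Algebra.lsmul ℂ ℂ G.Pre b).mkContinuous ‖b‖ (G.norm_smul_le_mul b)

theorem lsmulPre_apply (b : B) (f : G.Pre) : G.lsmulPre b f = b • f := rfl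

/-- The GNS representation of a positive kernel. -/
def rep : HilbertRep B where
  space := UniformSpace.Completion G.Pre
  hom :=
  { toFun := fun b => (G.lsmulPre b).completion
    map_one' := ext_of_eqOn_coe fun f => by simp [lsmulPre_apply]
    map_mul' := fun a b => ext_of_eqOn_coe fun f => by simp [lsmulPre_apply, mul_smul]
    map_zero' := ext_of_eqOn_coe fun f => by
      rw [ContinuousLinearMap.completion_apply_coe, lsmulPre_apply, zero_smul]
      exact UniformSpace.Completion.coe_zero
    map_add' := fun a b => ext_of_eqOn_coe fun f => by
      simp [lsmulPre_apply, add_smul, UniformSpace.Completion.coe_add]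
    commutes' := fun c => ext_of_eqOn_coe fun f => by
      simp [lsmulPre_apply, Algebra.algebraMap_eq_smul_one, UniformSpace.Completion.coe_smul]
    map_star' := fun b => by
      rw [ContinuousLinearMap.star_eq_adjoint, ContinuousLinearMap.eq_adjoint_iff]
      intro z w
      refine UniformSpace.Completion.induction_on₂ z w
        (isClosed_eq (by fun_prop) (by fun_prop)) fun f g => ?_
      simp [lsmulPre_apply, inner_smul_left_eq] }

/-- The image of the vector `1` at `k`. -/
def vec (k : K) : G.rep.space :=
  (G.toPre (Finsupp.single k 1) : UniformSpace.Completion G.Pre)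

theorem inner_vec_hom_vec (k l : K) (b : B) :
    ⟪G.vec k, G.rep.hom b (G.vec l)⟫_ℂ = G.toLinearMap (Finsupp.single (k, l) b) := by
  have h_hom : G.rep.hom b (G.vec l) =
      (G.toPre (b • Finsupp.single l 1) : UniformSpace.Completion G.Pre) :=
    ContinuousLinearMap.completion_apply_coe (G.lsmulPre b) _
  rw [h_hom]
  refine (UniformSpace.Completion.inner_coe _ _).trans ?_
  rw [inner_toPre, Finsupp.smul_single, outer_single_single, star_one, one_mul, smul_eq_mul,
    mul_one]

end PositiveKernel

section AccretiveCone

attribute [local instance] CStarAlgebra.spectralOrder CStarAlgebra.spectralOrderedRing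

open CStarMatrix

variable {K B : Type*} [CStarAlgebra B]

/-- The block of `m + m⋆` with indices in the finite set `T`. -/
def hermitianBlock (T : Finset K) : (K × K →₀ B) →ₗ[ℝ] CStarMatrix T T B where
  toFun m := ofMatrix (Matrix.of fun i j => m (i, j) + star (m (j, i)))
  map_add' m n := by
    ext i j
    simp only [ofMatrix_apply, Matrix.of_apply, CStarMatrix.add_apply, Finsupp.add_apply, star_add]
    abel
  map_smul' r m := by
    ext i j
    simp only [ofMatrix_apply, Matrix.of_apply, CStarMatrix.smul_apply, Finsupp.smul_apply,
      star_smul, star_trivial, smul_add, RingHom.id_apply]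

theorem hermitianBlock_apply (T : Finset K) (m : K × K →₀ B) (i j : T) :
    hermitianBlock T m i j = m (i, j) + star (m (j, i)) := rfl

variable (K B) in
/-- The cone of the finitely supported matrices `m` with `m + m⋆` positive. -/
def accretiveCone : PointedCone ℝ (K × K →₀ B) where
  carrier := {m | ∀ T, 0 ≤ hermitianBlock T m}
  zero_mem' T := (map_zero (hermitianBlock T)).ge
  add_mem' hm hn T := (add_nonneg (hm T) (hn T)).trans_eq (map_add (hermitianBlock T) _ _).symm
  smul_mem' c m hm T := by
    classical
    exact (smul_nonneg c.2 (hm T)).trans_eq ((hermitianBlock T).map_smul (c : ℝ) m).symm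

theorem mem_accretiveCone {m : K × K →₀ B} :
    m ∈ accretiveCone K B ↔ ∀ T, 0 ≤ hermitianBlock T m := Iff.rfl

theorem mem_accretiveCone_of_antihermitian {m : K × K →₀ B}
    (h : ∀ k l, m (k, l) + star (m (l, k)) = 0) : m ∈ accretiveCone K B := fun T =>
  le_of_eq (by ext i j; exact (h i j).symm)

theorem outer_self_mem_accretiveCone (f : K →₀ B) : outer f f ∈ accretiveCone K B := fun T => by
  refine (add_nonneg (rowGram_nonneg fun i : T => f i)
    (rowGram_nonneg fun i : T => f i)).trans_eq ?_
  ext i j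
  simp [hermitianBlock_apply, rowGram_apply, outer_apply]

theorem single_sub_single_star_mem_accretiveCone (k l : K) (b : B) :
    Finsupp.single (k, l) b - Finsupp.single (l, k) (star b) ∈ accretiveCone K B := by
  classical
  refine mem_accretiveCone_of_antihermitian fun p q => ?_
  simp only [Finsupp.sub_apply, Finsupp.single_apply, Prod.mk.injEq, star_sub, apply_ite star,
    star_star, star_zero, and_comm (a := k = q), and_comm (a := l = q)]
  abel

/-- With `c⋆c = ‖b‖² - b⋆b`, the sum of the positive matrices `(1, b)⋆(1, b)` and `(0, c)⋆(0, c)`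
has diagonal `1, ‖b‖²` and off-diagonal entries `b, b⋆`. -/
theorem exists_diagonal_add_single_mem_accretiveCone (k l : K) (b : B) : ∃ s t : ℂ,
    Finsupp.single (k, k) (s • 1) + Finsupp.single (l, l) (t • 1) + Finsupp.single (k, l) b
      ∈ accretiveCone K B := by
  let b₀ : B := (1 / 2 : ℂ) • b
  obtain ⟨c, hc⟩ := exists_eq_star_mul_self (sub_nonneg.2 (star_mul_self_le_smul_one b₀))
  refine ⟨1, ((‖b₀‖ ^ 2 : ℝ) : ℂ), ?_⟩
  let f : K →₀ B := Finsupp.single k 1 + Finsupp.single l b₀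
  have h_mem := add_mem (add_mem (outer_self_mem_accretiveCone f)
    (outer_self_mem_accretiveCone (Finsupp.single l c)))
    (single_sub_single_star_mem_accretiveCone k l b₀)
  have h_norm : ((‖b₀‖ ^ 2 : ℝ) : ℂ) • (1 : B) = star b₀ * b₀ + star c * c := by
    rw [← hc, add_sub_cancel]
  have h_half : b = b₀ + b₀ := by
    rw [← add_smul, add_halves, one_smul]
  rw [h_norm, h_half, one_smul]
  convert h_mem using 1
  simp only [f, map_add, LinearMap.add_apply, outer_single_single, Finsupp.single_add, star_one,
    one_mul, mul_one]
  abel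

/-- A positive kernel from a real functional, which vanishes on anti-Hermitian matrices as these
form a subspace of the cone. -/
def PositiveKernel.ofReal (g : (K × K →₀ B) →ₗ[ℝ] ℝ) (hg : ∀ m ∈ accretiveCone K B, 0 ≤ g m) :
    PositiveKernel K B where
  toLinearMap := Module.Dual.extendRCLike g
  re_nonneg f := (hg _ (outer_self_mem_accretiveCone f)).trans_eq
    (Module.Dual.re_extendRCLike_apply (𝕜 := ℂ) g _).symm
  conj_symm f f' := by
    have h_zero (m : K × K →₀ B) (hm : ∀ k l, m (k, l) + star (m (l, k)) = 0) : g m = 0 := by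
      refine le_antisymm ?_ (hg m (mem_accretiveCone_of_antihermitian hm))
      have h_neg := hg (-m) (mem_accretiveCone_of_antihermitian fun k l => by
        rw [Finsupp.neg_apply, Finsupp.neg_apply, star_neg, ← neg_add, hm, neg_zero])
      rwa [map_neg, neg_nonneg] at h_neg
    have h_re : g (outer f' f) - g (outer f f') = 0 := by
      rw [← map_sub]
      exact h_zero _ fun k l => by simp [outer_apply]
    have h_im : g (Complex.I • outer f' f) + g (Complex.I • outer f f') = 0 := by
      rw [← map_add]
      exact h_zero _ fun k l => by simp [outer_apply]
    rw [Module.Dual.extendRCLike_apply, Module.Dual.extendRCLike_apply]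
    apply Complex.ext
    · simpa using sub_eq_zero.1 h_re
    · simpa using eq_neg_of_add_eq_zero_left h_im

theorem PositiveKernel.re_ofReal (g : (K × K →₀ B) →ₗ[ℝ] ℝ)
    (hg : ∀ m ∈ accretiveCone K B, 0 ≤ g m) (m : K × K →₀ B) :
    ((ofReal g hg).toLinearMap m).re = g m :=
  Module.Dual.re_extendRCLike_apply (𝕜 := ℂ) g m

end AccretiveCone

namespace HilbertRep

section Kernel

attribute [local instance] CStarAlgebra.spectralOrder CStarAlgebra.spectralOrderedRing

open CStarMatrix

variable {A : Type u} [CStarAlgebra A] (σ : HilbertRep A)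

/-- The functional `m ↦ ∑ ⟪k, σ(m(k, l)) l⟫`. -/
def kernel : (σ.space × σ.space →₀ A) →ₗ[ℂ] ℂ :=
  Finsupp.lsum ℂ fun p => (innerSL ℂ p.1).toLinearMap ∘ₗ
    (ContinuousLinearMap.apply ℂ σ.space p.2).toLinearMap ∘ₗ σ.hom.toAlgHom.toLinearMap

theorem kernel_single (k l : σ.space) (a : A) :
    σ.kernel (Finsupp.single (k, l) a) = ⟪k, σ.hom a l⟫_ℂ := by
  simp [kernel]

theorem kernel_eq_sum (m : σ.space × σ.space →₀ A) (T : Finset σ.space)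
    (hT : m.support ⊆ T ×ˢ T) :
    σ.kernel m = ∑ k : T, ∑ l : T, ⟪(k : σ.space), σ.hom (m (k, l)) l⟫_ℂ := by
  rw [kernel, Finsupp.lsum_apply, Finsupp.sum_of_support_subset _ hT _ (by simp),
    Finset.sum_product, ← Finset.sum_coe_sort T]
  exact Finset.sum_congr rfl fun k _ => (Finset.sum_coe_sort T _).symm

theorem inner_hom_star (a : A) (v w : σ.space) :
    ⟪v, σ.hom (star a) w⟫_ℂ = ⟪σ.hom a v, w⟫_ℂ := by
  rw [map_star, ContinuousLinearMap.star_eq_adjoint, ContinuousLinearMap.adjoint_inner_right]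

theorem re_sum_inner_nonneg {n : Type*} [Fintype n] (v : n → σ.space) {M : CStarMatrix n n A}
    (hM : 0 ≤ M) : 0 ≤ (∑ i, ∑ j, ⟪v i, σ.hom (M i j) (v j)⟫_ℂ).re := by
  classical
  obtain ⟨N, rfl⟩ := exists_eq_star_mul_self (D := CStarMatrix n n A) hM
  have h_sum : ∑ i, ∑ j, ⟪v i, σ.hom ((star N * N) i j) (v j)⟫_ℂ =
      ∑ k, ⟪∑ i, σ.hom (N k i) (v i), ∑ j, σ.hom (N k j) (v j)⟫_ℂ := by
    simp only [mul_apply, map_sum, sum_inner, inner_sum, star_apply, map_mul, sum_apply,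
      mul_apply_eq_comp, inner_hom_star]
    rw [Finset.sum_congr rfl fun i _ => Finset.sum_comm, Finset.sum_comm]
    exact Finset.sum_congr rfl fun k _ => Finset.sum_comm
  rw [h_sum, Complex.re_sum]
  exact Finset.sum_nonneg fun k _ => inner_self_nonneg (𝕜 := ℂ)

theorem re_kernel_nonneg {m : σ.space × σ.space →₀ A} (hm : m ∈ accretiveCone σ.space A) :
    0 ≤ (σ.kernel m).re := by
  classical
  let T := m.support.image Prod.fst ∪ m.support.image Prod.snd
  have hT : m.support ⊆ T ×ˢ T := fun p hp => Finset.mem_product.2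
    ⟨Finset.mem_union_left _ (Finset.mem_image_of_mem _ hp),
      Finset.mem_union_right _ (Finset.mem_image_of_mem _ hp)⟩
  have h_star (k l : T) : ⟪(k : σ.space), σ.hom (star (m (l, k))) l⟫_ℂ =
      star ⟪(l : σ.space), σ.hom (m (l, k)) k⟫_ℂ := by
    rw [inner_hom_star]
    exact (inner_conj_symm _ _).symm
  have h_herm : ∑ k : T, ∑ l : T, ⟪(k : σ.space), σ.hom (hermitianBlock T m k l) l⟫_ℂ =
      σ.kernel m + star (σ.kernel m) := by
    rw [σ.kernel_eq_sum m T hT]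
    simp only [hermitianBlock_apply, map_add, _root_.add_apply, inner_add_right,
      Finset.sum_add_distrib, star_sum, h_star]
    rw [Finset.sum_comm (f := fun k l : T => star _)]
  have h_nonneg := σ.re_sum_inner_nonneg (fun k : T => (k : σ.space)) (hm T)
  rw [h_herm, Complex.add_re, Complex.star_def, Complex.conj_re] at h_nonneg
  linarith

end Kernel

section Extension

attribute [local instance] CStarAlgebra.spectralOrder CStarAlgebra.spectralOrderedRing

variable {A B : Type u} [CStarAlgebra A] [CStarAlgebra B] {ψ : A →ₗ[ℂ] B}

theorem mapRange_mem_accretiveCone_iff {K : Type*} (hψ : IsUCP ψ) (hi : IsCompletelyIsometric ψ)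
    {m : K × K →₀ A} :
    Finsupp.mapRange.linearMap ψ m ∈ accretiveCone K B ↔ m ∈ accretiveCone K A := by
  have h_map (T : Finset K) : hermitianBlock T (Finsupp.mapRange.linearMap ψ m) =
      (hermitianBlock T m).map ψ := by
    ext i j
    simp [hermitianBlock_apply, hψ.map_star]
  simp only [mem_accretiveCone, h_map]
  exact forall_congr' fun T => ⟨hi.nonneg_of_map_nonneg hψ, hψ.map_matrix_nonneg⟩

theorem exists_mapRange_add_mem_accretiveCone {K : Type*} (h_one : ψ 1 = 1) (m : K × K →₀ B) :
    ∃ n : K × K →₀ A, Finsupp.mapRange.linearMap ψ n + m ∈ accretiveCone K B := by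
  induction m using Finsupp.induction_linear with
  | zero => exact ⟨0, by simp⟩
  | add m₁ m₂ h₁ h₂ =>
    obtain ⟨n₁, hn₁⟩ := h₁
    obtain ⟨n₂, hn₂⟩ := h₂
    refine ⟨n₁ + n₂, ?_⟩
    rw [map_add, add_add_add_comm]
    exact add_mem hn₁ hn₂
  | single p b =>
    obtain ⟨s, t, h⟩ := exists_diagonal_add_single_mem_accretiveCone p.1 p.2 b
    refine ⟨Finsupp.single (p.1, p.1) (s • 1) + Finsupp.single (p.2, p.2) (t • 1), ?_⟩
    rw [map_add]
    simpa [h_one] using h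

variable (σ : HilbertRep A)

/-- M. Riesz' extension theorem for the real part of the kernel of `σ`, moved to the image
of `ψ`. -/
theorem exists_real_extension (hψ : IsUCP ψ) (hi : IsCompletelyIsometric ψ) :
    ∃ g : (σ.space × σ.space →₀ B) →ₗ[ℝ] ℝ,
      (∀ m, g (Finsupp.mapRange.linearMap ψ m) = (σ.kernel m).re) ∧
      ∀ m ∈ accretiveCone σ.space B, 0 ≤ g m := by
  let ι : (σ.space × σ.space →₀ A) →ₗ[ℝ] (σ.space × σ.space →₀ B) :=
    (Finsupp.mapRange.linearMap ψ).restrictScalars ℝ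
  have h_inj : Function.Injective ι := Finsupp.mapRange_injective ψ (map_zero ψ)
    (AddMonoidHomClass.isometry_of_norm ψ hi.norm_map).injective
  let e := LinearEquiv.ofInjective ι h_inj
  let f : (σ.space × σ.space →₀ B) →ₗ.[ℝ] ℝ :=
    { domain := LinearMap.range ι
      toFun := Complex.reLm ∘ₗ σ.kernel.restrictScalars ℝ ∘ₗ e.symm.toLinearMap }
  have hf (m) : f (e m) = (σ.kernel m).re := by
    simp [f, LinearPMap.mk_apply]
  obtain ⟨g, hg, h_pos⟩ := riesz_extension (accretiveCone σ.space B) f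
    (fun x hx => by
      obtain ⟨m, rfl⟩ := e.surjective x
      exact (σ.re_kernel_nonneg ((mapRange_mem_accretiveCone_iff hψ hi).1 hx)).trans_eq
        (hf m).symm)
    (fun y => (exists_mapRange_add_mem_accretiveCone hψ.1 y).imp' e fun _ hm => hm)
  exact ⟨g, fun m => (hg (e m)).trans (hf m), h_pos⟩

theorem exists_positiveKernel (hψ : IsUCP ψ) (hi : IsCompletelyIsometric ψ) :
    ∃ G : PositiveKernel σ.space B,
      ∀ k l a, G.toLinearMap (Finsupp.single (k, l) (ψ a)) = ⟪k, σ.hom a l⟫_ℂ := by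
  obtain ⟨g, hg, h_pos⟩ := σ.exists_real_extension hψ hi
  let G := PositiveKernel.ofReal g h_pos
  have h_eq : G.toLinearMap ∘ₗ Finsupp.mapRange.linearMap ψ = σ.kernel :=
    ext_of_re_eq fun m => (PositiveKernel.re_ofReal g h_pos _).trans (hg m)
  refine ⟨G, fun k l a => ?_⟩
  simpa [kernel_single] using LinearMap.congr_fun h_eq (Finsupp.single (k, l) a)

theorem inner_hom_star_mul_self (a : A) (v : σ.space) :
    ⟪v, σ.hom (star a * a) v⟫_ℂ = ((‖σ.hom a v‖ ^ 2 : ℝ) : ℂ) := by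
  rw [map_mul, mul_apply_eq_comp, inner_hom_star, inner_self_eq_norm_sq_to_K, Complex.ofReal_pow]
  rfl

theorem norm_hom_apply_sq_le {a b : A} (h : star a * a ≤ b) (v : σ.space) :
    ‖σ.hom a v‖ ^ 2 ≤ (⟪v, σ.hom b v⟫_ℂ).re := by
  obtain ⟨c, hc⟩ := exists_eq_star_mul_self (sub_nonneg.2 h)
  rw [← sub_add_cancel b (star a * a), hc, map_add, add_apply, inner_add_right,
    inner_hom_star_mul_self, inner_hom_star_mul_self, Complex.add_re, Complex.ofReal_re,
    Complex.ofReal_re]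
  exact le_add_of_nonneg_left (sq_nonneg _)

/-- As `⟪V k, τ(ψ(a)) V k⟫ = ⟪k, σ(a) k⟫`, the Schwarz inequality gives
`‖τ(ψ(a)) V k‖ ≤ ‖σ(a) k‖`, which forces `τ(ψ(a)) V k = V σ(a) k`. -/
theorem exists_extension (hψ : IsUCP ψ) (hi : IsCompletelyIsometric ψ) :
    ∃ (τ : HilbertRep B) (V : σ.space →ₗᵢ[ℂ] τ.space),
      ∀ a k, τ.hom (ψ a) (V k) = V (σ.hom a k) := by
  obtain ⟨G, hG⟩ := σ.exists_positiveKernel hψ hi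
  have h_vec (k l a) : ⟪G.vec k, G.rep.hom (ψ a) (G.vec l)⟫_ℂ = ⟪k, σ.hom a l⟫_ℂ := by
    rw [G.inner_vec_hom_vec, hG]
  obtain ⟨V, hV⟩ := exists_linearIsometry_of_inner (𝕜 := ℂ) G.vec fun k l => by
    simpa [hψ.1] using h_vec k l 1
  refine ⟨G.rep, V, fun a k => ?_⟩
  simp only [← hV] at h_vec
  have h_le : ‖G.rep.hom (ψ a) (V k)‖ ^ 2 ≤ ‖σ.hom a k‖ ^ 2 := by
    refine (G.rep.norm_hom_apply_sq_le (hψ.schwarz a) (V k)).trans_eq ?_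
    rw [h_vec, inner_hom_star_mul_self, Complex.ofReal_re]
  rw [← sub_eq_zero, ← norm_eq_zero, ← sq_eq_zero_iff]
  refine le_antisymm ?_ (sq_nonneg _)
  rw [norm_sub_sq (𝕜 := ℂ), V.norm_map, ← inner_re_symm, h_vec, inner_self_eq_norm_sq]
  linarith

end Extension

end HilbertRep

theorem exists_character_norm_eq {C : Type*} [CommCStarAlgebra C] [Nontrivial C] (x : C) :
    ∃ χ : WeakDual.characterSpace ℂ C, ‖χ x‖ = ‖x‖ := by
  let f := WeakDual.gelfandTransform ℂ C x
  have h_norm : ‖f‖ = ‖x‖ :=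
    (AddMonoidHomClass.isometry_iff_norm _).1 (gelfandTransform_isometry C) x
  obtain ⟨χ, -, hχ⟩ :=
    isCompact_univ.exists_isMaxOn Set.univ_nonempty f.continuous.norm.continuousOn
  rw [← h_norm]
  exact ⟨χ, (f.norm_coe_le_norm χ).antisymm
    ((ContinuousMap.norm_le _ (norm_nonneg _)).2 fun χ' => hχ (Set.mem_univ χ'))⟩

namespace HilbertRep

variable {A : Type u} [CStarAlgebra A]

/-- The one-dimensional representation given by a character. -/
def ofCharacter {C : Type u} [CStarAlgebra C] (χ : C →⋆ₐ[ℂ] ℂ) : HilbertRep C where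
  space := EuclideanSpace ℂ PUnit.{u + 1}
  hom := (StarAlgHom.ofId ℂ _).comp χ

/-- A character of the C⋆-algebra generated by `a⋆a` that is `‖a⋆a‖` at `a⋆a` extends to a
representation of `A` on a larger space. -/
theorem exists_norm_le_norm_hom [Nontrivial A] (a : A) : ∃ τ : HilbertRep A, ‖a‖ ≤ ‖τ.hom a‖ := by
  have h_normal : IsStarNormal (star a * a) := (IsSelfAdjoint.star_mul_self a).isStarNormal
  let C := StarAlgebra.elemental ℂ (star a * a)
  let x : C := ⟨star a * a, StarAlgebra.elemental.self_mem ℂ _⟩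
  obtain ⟨χ, hχ⟩ := exists_character_norm_eq x
  let σ : HilbertRep C := ofCharacter (χ : C →⋆ₐ[ℂ] ℂ)
  let v : σ.space := EuclideanSpace.single PUnit.unit (1 : ℂ)
  have hv : ‖v‖ = 1 := (PiLp.norm_single _ _ _ _).trans norm_one
  obtain ⟨τ, V, hV⟩ := σ.exists_extension (IsUCP.of_starAlgHom C.subtype)
    (IsCompletelyIsometric.of_starAlgHom C.subtype Subtype.val_injective)
  have h_attained : ‖τ.hom (star a * a) (V v)‖ = ‖star a * a‖ := by
    have h_eigen : τ.hom (star a * a) (V v) = V (χ x • v) := hV x v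
    rw [h_eigen, V.norm_map, norm_smul, hv, mul_one, hχ]
    rfl
  have h_le := (τ.hom (star a * a)).le_opNorm (V v)
  rw [h_attained, V.norm_map, hv, mul_one, map_mul, map_star, CStarRing.norm_star_mul_self,
    CStarRing.norm_star_mul_self] at h_le
  exact ⟨τ, abs_le_of_sq_le_sq' (by nlinarith) (norm_nonneg _) |>.2⟩

theorem eq_zero_of_forall {a : A} (h : ∀ τ : HilbertRep A, τ.hom a = 0) : a = 0 := by
  rcases subsingleton_or_nontrivial A with hA | hA
  · exact Subsingleton.elim a 0
  · obtain ⟨τ, hτ⟩ := exists_norm_le_norm_hom a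
    rwa [h, norm_zero, norm_le_zero_iff] at hτ

end HilbertRep

section MapRightIsometry

variable (H : Type u) {K L : Type u} [NormedAddCommGroup H] [InnerProductSpace ℂ H]
  [NormedAddCommGroup K] [InnerProductSpace ℂ K] [NormedAddCommGroup L] [InnerProductSpace ℂ L]

/-- The isometry `1 ⊗ V`. -/
def HilbertTensor.mapRightIsometry (V : K →ₗᵢ[ℂ] L) :
    HilbertTensor H K →ₗᵢ[ℂ] HilbertTensor H L :=
  let W : HilbertTensor H K →L[ℂ] HilbertTensor H L :=
    (V.lTensor H).toContinuousLinearMap.completion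
  { toLinearMap := W.toLinearMap
    norm_map' := fun z => UniformSpace.Completion.induction_on (p := fun z => ‖W z‖ = ‖z‖) z
      (isClosed_eq W.continuous.norm continuous_norm) fun t => by
        refine (congrArg norm (ContinuousLinearMap.completion_apply_coe _ _)).trans ?_
        refine (UniformSpace.Completion.norm_coe _).trans ?_
        exact ((V.lTensor H).norm_map t).trans (UniformSpace.Completion.norm_coe _).symm }

theorem HilbertTensor.mapRightIsometry_tmul (V : K →ₗᵢ[ℂ] L) (x : H) (y : K) :
    mapRightIsometry H V (tmul x y) = tmul x (V y) :=
  ContinuousLinearMap.completion_apply_coe _ _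

end MapRightIsometry

section MinTensorMap

variable {C A B : Type u} [CStarAlgebra C] [CStarAlgebra A] [CStarAlgebra B]

/-- The pullback of a representation. -/
def HilbertRep.comp (σ : HilbertRep B) (φ : A →⋆ₐ[ℂ] B) : HilbertRep A where
  space := σ.space
  hom := σ.hom.comp φ

theorem HilbertRep.tensor_comp (ρ : HilbertRep C) (σ : HilbertRep B) (φ : A →⋆ₐ[ℂ] B)
    (t : C ⊗[ℂ] A) : ρ.tensor (σ.comp φ) t = ρ.tensor σ (φ.toAlgHom.toLinearMap.lTensor C t) := by
  suffices (ρ.tensor (σ.comp φ)).toLinearMap =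
      (ρ.tensor σ).toLinearMap ∘ₗ φ.toAlgHom.toLinearMap.lTensor C from LinearMap.congr_fun this t
  refine TensorProduct.ext' fun c a => ?_
  exact (tensor_tmul ρ (σ.comp φ) c a).trans (tensor_tmul ρ σ c (φ a)).symm

theorem HilbertRep.tensor_mapRightIsometry (ρ : HilbertRep C) {σ : HilbertRep A} {τ : HilbertRep B}
    {V : σ.space →ₗᵢ[ℂ] τ.space} {φ : A →ₗ[ℂ] B}
    (hV : ∀ a v, τ.hom (φ a) (V v) = V (σ.hom a v)) (t : C ⊗[ℂ] A)
    (z : HilbertTensor ρ.space σ.space) :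
    ρ.tensor τ (φ.lTensor C t) (HilbertTensor.mapRightIsometry ρ.space V z) =
      HilbertTensor.mapRightIsometry ρ.space V (ρ.tensor σ t z) := by
  induction t with
  | zero => simp
  | add s t hs ht => simp only [map_add, add_apply, hs, ht]
  | tmul c a =>
    rw [LinearMap.lTensor_tmul, tensor_tmul, tensor_tmul]
    refine HilbertTensor.induction (P := fun z => HilbertTensor.map (ρ.hom c) (τ.hom (φ a))
      (HilbertTensor.mapRightIsometry ρ.space V z) = HilbertTensor.mapRightIsometry ρ.space V
        (HilbertTensor.map (ρ.hom c) (σ.hom a) z)) z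
      (isClosed_eq (by fun_prop) (by fun_prop)) (fun x y => ?_) fun z z' hz hz' => ?_
    · simp only [HilbertTensor.mapRightIsometry_tmul, HilbertTensor.map_tmul, hV]
    · simp only [map_add, hz, hz']

theorem minNorm_lTensor_le (φ : A →⋆ₐ[ℂ] B) (t : C ⊗[ℂ] A) :
    minNorm (φ.toAlgHom.toLinearMap.lTensor C t) ≤ minNorm t :=
  Real.iSup_le (fun p => by
    rw [← HilbertRep.tensor_comp]
    exact norm_tensor_le_minNorm t (p.1, p.2.comp φ)) (minNorm_nonneg _)

theorem minNorm_lTensor_of_injective {φ : A →⋆ₐ[ℂ] B} (hφ : Function.Injective φ)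
    (t : C ⊗[ℂ] A) : minNorm (φ.toAlgHom.toLinearMap.lTensor C t) = minNorm t := by
  refine (minNorm_lTensor_le φ t).antisymm (Real.iSup_le (fun p => ?_) (minNorm_nonneg _))
  obtain ⟨ρ, σ⟩ := p
  obtain ⟨τ, V, hV⟩ := σ.exists_extension (IsUCP.of_starAlgHom φ)
    (IsCompletelyIsometric.of_starAlgHom φ hφ)
  refine ContinuousLinearMap.opNorm_le_bound _ (minNorm_nonneg _) fun z => ?_
  let W := HilbertTensor.mapRightIsometry ρ.space V
  rw [← W.norm_map, ← ρ.tensor_mapRightIsometry hV, ← W.norm_map z]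
  exact ContinuousLinearMap.le_of_opNorm_le _ (norm_tensor_le_minNorm _ (ρ, τ)) _

namespace MinTensor

variable (C) in
/-- The homomorphism `ι ⊗ φ` of algebraic tensor products, as a map of seminormed rings. -/
def preMapRight (φ : A →⋆ₐ[ℂ] B) : PreMinTensor C A →+* PreMinTensor C B :=
  (Algebra.TensorProduct.map (AlgHom.id ℂ C) φ.toAlgHom).toRingHom

theorem continuous_preMapRight (φ : A →⋆ₐ[ℂ] B) : Continuous (preMapRight C φ) :=
  AddMonoidHomClass.continuous_of_bound (preMapRight C φ) 1 fun t =>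
    (minNorm_lTensor_le φ t).trans_eq (one_mul _).symm

variable (C) in
/-- The homomorphism `ι ⊗ φ` of minimal tensor products, as a ring homomorphism. -/
def mapRightRingHom (φ : A →⋆ₐ[ℂ] B) : MinTensor C A →+* MinTensor C B :=
  UniformSpace.Completion.mapRingHom (preMapRight C φ) (continuous_preMapRight φ)

theorem continuous_mapRightRingHom (φ : A →⋆ₐ[ℂ] B) : Continuous (mapRightRingHom C φ) :=
  UniformSpace.Completion.continuous_map

theorem mapRightRingHom_of (φ : A →⋆ₐ[ℂ] B) (t : C ⊗[ℂ] A) :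
    mapRightRingHom C φ (of t) = of (φ.toAlgHom.toLinearMap.lTensor C t) :=
  UniformSpace.Completion.mapRingHom_coe (continuous_preMapRight φ) (show PreMinTensor C A from t)

theorem lTensor_star (φ : A →⋆ₐ[ℂ] B) (t : C ⊗[ℂ] A) :
    φ.toAlgHom.toLinearMap.lTensor C (star t) = star (φ.toAlgHom.toLinearMap.lTensor C t) := by
  induction t with
  | zero => simp
  | add s t hs ht => simp only [star_add, map_add, hs, ht]
  | tmul c a =>
    simp only [TensorProduct.star_tmul, LinearMap.lTensor_tmul]
    exact congrArg _ (map_star φ a)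

variable (C) in
/-- The `⋆`-homomorphism `ι ⊗ φ` of minimal tensor products. -/
def mapRight (φ : A →⋆ₐ[ℂ] B) : MinTensor C A →⋆ₐ[ℂ] MinTensor C B :=
  { mapRightRingHom C φ with
    commutes' := fun c => (mapRightRingHom_of φ (algebraMap ℂ (C ⊗[ℂ] A) c)).trans <|
      congrArg of ((Algebra.TensorProduct.map (AlgHom.id ℂ C) φ.toAlgHom).commutes c)
    map_star' := fun x => by
      refine MinTensor.induction (P := fun x => mapRightRingHom C φ (star x) =
        star (mapRightRingHom C φ x)) x
        (isClosed_eq ((continuous_mapRightRingHom φ).comp continuous_star)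
          (continuous_star.comp (continuous_mapRightRingHom φ))) fun t => ?_
      rw [← of_star, mapRightRingHom_of, mapRightRingHom_of, ← of_star, lTensor_star] }

theorem mapRight_of (φ : A →⋆ₐ[ℂ] B) (t : C ⊗[ℂ] A) :
    mapRight C φ (of t) = of (φ.toAlgHom.toLinearMap.lTensor C t) := mapRightRingHom_of φ t

theorem norm_mapRight_of_injective {φ : A →⋆ₐ[ℂ] B} (hφ : Function.Injective φ)
    (x : MinTensor C A) : ‖mapRight C φ x‖ = ‖x‖ := by
  refine MinTensor.induction (P := fun x => ‖mapRight C φ x‖ = ‖x‖) x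
    (isClosed_eq (continuous_mapRightRingHom φ).norm continuous_norm) fun t => ?_
  rw [mapRight_of, norm_of, norm_of, minNorm_lTensor_of_injective hφ]

theorem mapRight_injective {φ : A →⋆ₐ[ℂ] B} (hφ : Function.Injective φ) :
    Function.Injective (mapRight C φ) :=
  (AddMonoidHomClass.isometry_of_norm _ (norm_mapRight_of_injective hφ)).injective

end MinTensor

end MinTensorMap

section RegularEmb

variable {O : Type u} [Ring O] [StarRing O] [HopfAlgebra ℂ O] [StarModule ℂ O]
  [CompactQuantumGroup O] {A B : Type u} [CStarAlgebra A] [CStarAlgebra B]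

theorem regularEmb_tmul (x : O) (a : A) :
    regularEmb O A (x ⊗ₜ a) = MinTensor.of (toReduced O x ⊗ₜ a) := rfl

theorem mapRight_regularEmb (φ : A →⋆ₐ[ℂ] B) (t : O ⊗[ℂ] A) :
    MinTensor.mapRight (ReducedCStar O) φ (regularEmb O A t) =
      regularEmb O B (φ.toAlgHom.toLinearMap.lTensor O t) := by
  induction t with
  | zero => simp
  | add s t hs ht => simp only [map_add, hs, ht]
  | tmul x a =>
    rw [LinearMap.lTensor_tmul, regularEmb_tmul, regularEmb_tmul, MinTensor.mapRight_of,
      LinearMap.lTensor_tmul]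

theorem regularEmb_star (t : O ⊗[ℂ] A) : regularEmb O A (star t) = star (regularEmb O A t) := by
  induction t with
  | zero => simp
  | add s t hs ht => simp only [star_add, map_add, hs, ht]
  | tmul x a =>
    rw [TensorProduct.star_tmul, regularEmb_tmul, regularEmb_tmul, ← MinTensor.of_star,
      TensorProduct.star_tmul, map_star]

end RegularEmb

section Subcomodule

open Coalgebra (comul counit)

variable {k O : Type*} [Field k] [AddCommGroup O] [Module k O] [Coalgebra k O]

/-- The slice `x ↦ (ι ⊗ φ)Δ(x)` of the comultiplication by a functional `φ`. -/
def comulSlice (φ : Module.Dual k O) : O →ₗ[k] O :=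
  (TensorProduct.rid k O).toLinearMap ∘ₗ φ.lTensor O ∘ₗ comul

theorem comul_comulSlice (φ : Module.Dual k O) (x : O) :
    comul (R := k) (comulSlice φ x) = (comulSlice φ).lTensor O (comul x) := by
  have h_assoc (t : O ⊗[k] O) (z : O) :
      ((TensorProduct.rid k O).toLinearMap ∘ₗ φ.lTensor O).lTensor O
        (TensorProduct.assoc k O O O (t ⊗ₜ z)) = φ z • t := by
    induction t with
    | zero => simp
    | add s t hs ht => rw [TensorProduct.add_tmul, map_add, map_add, hs, ht, smul_add]
    | tmul a b => simp
  have h_slice (t : O ⊗[k] O) : comul (R := k) (TensorProduct.rid k O (φ.lTensor O t)) =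
      ((TensorProduct.rid k O).toLinearMap ∘ₗ φ.lTensor O).lTensor O
        (TensorProduct.assoc k O O O (comul.rTensor O t)) := by
    induction t with
    | zero => simp
    | add s t hs ht => simp only [map_add, hs, ht]
    | tmul a b => rw [LinearMap.rTensor_tmul, h_assoc]; simp
  rw [comulSlice, LinearMap.comp_apply, LinearMap.comp_apply, LinearEquiv.coe_coe, h_slice,
    Coalgebra.coassoc_apply, ← LinearMap.lTensor_comp_apply]
  rfl

theorem comulSlice_counit (x : O) : comulSlice (counit (R := k)) x = x := by
  simp [comulSlice]

/-- If `Δ(x) = ∑ cₖ ⊗ eₖ` for a basis `e`, the slices `cₖ` span a subcomodule by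
coassociativity. -/
theorem exists_finiteDimensional_subcomodule (x : O) : ∃ V : Submodule k O, FiniteDimensional k V ∧
    x ∈ V ∧ ∀ y ∈ V, comul (R := k) y ∈ LinearMap.range (V.subtype.rTensor O) := by
  let e := Module.Basis.ofVectorSpace k O
  obtain ⟨c, hc⟩ := TensorProduct.eq_repr_basis_right e (comul (R := k) x)
  let V := Submodule.span k (c '' c.support)
  have h_mem (i) (hi : i ∈ c.support) : c i ∈ V :=
    Submodule.subset_span (Set.mem_image_of_mem c hi)
  have h_slice (φ : Module.Dual k O) : comulSlice φ x = ∑ i ∈ c.support, φ (e i) • c i := by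
    simp [comulSlice, ← hc, Finsupp.sum]
  have h_range : comul (R := k) x ∈ LinearMap.range (V.subtype.rTensor O) := by
    rw [← hc]
    exact sum_mem fun i hi => ⟨⟨c i, h_mem i hi⟩ ⊗ₜ e i, rfl⟩
  refine ⟨V, FiniteDimensional.span_of_finite k (c.support.finite_toSet.image c), ?_, ?_⟩
  · rw [← comulSlice_counit (k := k) x, h_slice]
    exact sum_mem fun i hi => V.smul_mem _ (h_mem i hi)
  · suffices V ≤ (LinearMap.range (V.subtype.rTensor O)).comap comul from fun y hy => this hy
    refine Submodule.span_le.2 ?_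
    rintro _ ⟨i, -, rfl⟩
    have h_coord : comulSlice (e.coord i) x = c i := by
      classical
      rw [h_slice]
      simpa [Finsupp.single_apply] using fun h => h.symm
    obtain ⟨t, ht⟩ := h_range
    refine ⟨(comulSlice (e.coord i)).lTensor V t, ?_⟩
    rw [← h_coord, comul_comulSlice, ← ht, ← LinearMap.comp_apply, ← LinearMap.comp_apply,
      LinearMap.rTensor_comp_lTensor, LinearMap.lTensor_comp_rTensor]

end Subcomodule

section MatrixCoefficients

open Coalgebra (comul counit)

variable {k O ι : Type*} [Field k] [Fintype ι] {v : ι → O} {u : Matrix ι ι O}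

section Coalgebra

variable [AddCommGroup O] [Module k O] [Coalgebra k O] {f : ι → Module.Dual k O}

theorem eq_sum_counit_smul_matrixCoeff
    (hv : ∀ j, comul (R := k) (v j) = ∑ i, v i ⊗ₜ[k] u i j) (j : ι) :
    v j = ∑ i, counit (R := k) (v i) • u i j := by
  have h := congrArg (TensorProduct.lid k O) (Coalgebra.rTensor_counit_comul (R := k) (v j))
  simpa [hv] using h.symm

variable [DecidableEq ι]

theorem comul_matrixCoeff (hf : ∀ i j, f i (v j) = if i = j then 1 else 0)
    (hv : ∀ j, comul (R := k) (v j) = ∑ i, v i ⊗ₜ[k] u i j) (i j : ι) :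
    comul (R := k) (u i j) = ∑ l, u i l ⊗ₜ[k] u l j := by
  have h := congrArg (fun t => TensorProduct.lid k (O ⊗[k] O) ((f i).rTensor (O ⊗[k] O) t))
    (Coalgebra.coassoc_apply (R := k) (v j))
  simp only [hv, map_sum, LinearMap.rTensor_tmul, LinearMap.lTensor_tmul,
    TensorProduct.sum_tmul, TensorProduct.assoc_tmul, TensorProduct.lid_tmul, hf] at h
  simpa using h.symm

theorem counit_matrixCoeff (hf : ∀ i j, f i (v j) = if i = j then 1 else 0)
    (hv : ∀ j, comul (R := k) (v j) = ∑ i, v i ⊗ₜ[k] u i j) (i j : ι) :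
    counit (R := k) (u i j) = if i = j then 1 else 0 := by
  have h := congrArg (fun t => f i (TensorProduct.rid k O t))
    (Coalgebra.lTensor_counit_comul (R := k) (v j))
  simpa [hv, hf] using h

end Coalgebra

theorem matrixCoeff_mul_antipode [DecidableEq ι] [Ring O] [HopfAlgebra k O]
    (h_comul : ∀ i j, comul (R := k) (u i j) = ∑ l, u i l ⊗ₜ[k] u l j)
    (h_counit : ∀ i j, counit (R := k) (u i j) = if i = j then 1 else 0) :
    u * u.map (HopfAlgebra.antipode k) = 1 := by
  ext i j
  have h := HopfAlgebra.mul_antipode_lTensor_comul_apply (R := k) (u i j)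
  rw [h_comul, h_counit] at h
  simpa [Matrix.mul_apply, Matrix.one_apply, apply_ite (algebraMap k O)] using h

end MatrixCoefficients

section UnitaryCorep

open CompactQuantumGroup
open Coalgebra (comul)

variable {O : Type u} [Ring O] [StarRing O] [HopfAlgebra ℂ O] [StarModule ℂ O]
  [CompactQuantumGroup O]

variable (O) in
/-- A finite dimensional unitary corepresentation of `ℂ[G]`, given by its matrix coefficients.
Unitarity is the condition `S(uᵢⱼ)⋆ = uⱼᵢ`. -/
structure UnitaryCorep (ι : Type*) [Fintype ι] where
  coeff : Matrix ι ι O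
  comul_coeff : ∀ i j, comul (R := ℂ) (coeff i j) = ∑ k, coeff i k ⊗ₜ[ℂ] coeff k j
  star_antipode_coeff : ∀ i j, star (HopfAlgebra.antipode ℂ (coeff i j)) = coeff j i

theorem conjTranspose_mul_matrixCoeff {ι : Type*} [Fintype ι] [DecidableEq ι] {v : ι → O}
    {u : Matrix ι ι O} (hv : ∀ j, comul (R := ℂ) (v j) = ∑ i, v i ⊗ₜ[ℂ] u i j)
    (h_orth : ∀ i j, haar (star (v i) * v j) = if i = j then 1 else 0) :
    u.conjTranspose * u = 1 := by
  ext i j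
  have h := haar_left (star (v i) * v j)
  rw [Bialgebra.comul_mul, comul_star, hv, hv] at h
  simp only [star_sum, TensorProduct.star_tmul, Finset.sum_mul_sum,
    Algebra.TensorProduct.tmul_mul_tmul, map_sum, LinearMap.rTensor_tmul,
    TensorProduct.lid_tmul, h_orth, ite_smul, one_smul, zero_smul] at h
  simpa [Matrix.mul_apply, Matrix.one_apply] using h

/-- The matrix coefficients with respect to an orthonormal basis for the Haar state. -/
def UnitaryCorep.ofOrthonormal {ι : Type*} [Fintype ι] [DecidableEq ι] {v : ι → O}
    {u : Matrix ι ι O} (hv : ∀ j, comul (R := ℂ) (v j) = ∑ i, v i ⊗ₜ[ℂ] u i j)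
    (h_orth : ∀ i j, haar (star (v i) * v j) = if i = j then 1 else 0) : UnitaryCorep O ι :=
  let f (i : ι) : Module.Dual ℂ O := haar ∘ₗ LinearMap.mulLeft ℂ (star (v i))
  { coeff := u
    comul_coeff := comul_matrixCoeff (f := f) h_orth hv
    star_antipode_coeff := fun i j => by
      have h_antipode : u.conjTranspose = u.map (HopfAlgebra.antipode ℂ) :=
        left_inv_eq_right_inv (conjTranspose_mul_matrixCoeff hv h_orth)
          (matrixCoeff_mul_antipode (comul_matrixCoeff (f := f) h_orth hv)
            (counit_matrixCoeff (f := f) h_orth hv))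
      rw [← star_star (u j i)]
      exact congrArg star (congrFun₂ h_antipode i j).symm }

theorem exists_orthonormal_spanning (V : Submodule ℂ O) [FiniteDimensional ℂ V] :
    ∃ (n : ℕ) (b : Module.Basis (Fin n) ℂ V),
      ∀ i j, haar (star (b i : O) * b j) = if i = j then 1 else 0 := by
  let W : Submodule ℂ (PreL2 O) := V.map (toPreL2 O).toLinearMap
  let e := stdOrthonormalBasis ℂ W
  exact ⟨_, e.toBasis.map ((toPreL2 O).submoduleMap V).symm, fun i j => by
    rw [← orthonormal_iff_ite.1 e.orthonormal i j]
    simp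
    rfl⟩

theorem exists_unitaryCorep (x : O) : ∃ (n : ℕ) (U : UnitaryCorep O (Fin n)),
    x ∈ Submodule.span ℂ (Set.range fun p : Fin n × Fin n => U.coeff p.1 p.2) := by
  obtain ⟨V, _, hx, hV⟩ := exists_finiteDimensional_subcomodule (k := ℂ) x
  obtain ⟨n, b, h_orth⟩ := exists_orthonormal_spanning V
  have h_comul (j : Fin n) :
      ∃ d : Fin n → O, comul (R := ℂ) (b j : O) = ∑ i, (b i : O) ⊗ₜ d i := by
    obtain ⟨t, ht⟩ := hV (b j) (b j).2
    obtain ⟨d, rfl⟩ := TensorProduct.eq_repr_basis_left b t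
    exact ⟨d, by simp [← ht, Finsupp.sum_fintype]⟩
  choose d hd using h_comul
  refine ⟨n, .ofOrthonormal (u := .of fun i j => d j i) hd h_orth, ?_⟩
  have h_sum : x = ∑ j, b.repr ⟨x, hx⟩ j • (b j : O) := by
    simpa only [map_sum, map_smul, Submodule.subtype_apply] using
      congrArg V.subtype (b.sum_repr ⟨x, hx⟩).symm
  rw [h_sum]
  refine sum_mem fun j _ => Submodule.smul_mem _ _ ?_
  rw [eq_sum_counit_smul_matrixCoeff (k := ℂ) (v := fun j => (b j : O))
    (u := .of fun i j => d j i) hd j]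
  exact sum_mem fun i _ => Submodule.smul_mem _ _ (Submodule.subset_span ⟨(i, j), rfl⟩)

end UnitaryCorep

namespace DualAction

attribute [local instance] CStarAlgebra.spectralOrder CStarAlgebra.spectralOrderedRing

open CStarMatrix

variable {O : Type u} [Ring O] [StarRing O] [HopfAlgebra ℂ O] {A : Type u} [CStarAlgebra A]
  (β : DualAction O A)

/-- The `⋆`-homomorphism `a ↦ (uᵢⱼ ▹ a)ᵢⱼ`. -/
def matrixHom {ι : Type*} [Fintype ι] (U : UnitaryCorep O ι) : A →⋆ₙₐ[ℂ] CStarMatrix ι ι A where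
  toFun a := ofMatrix <| .of fun i j => β.act (U.coeff i j) a
  map_smul' c a := by ext; simp [ofMatrix_apply]
  map_zero' := by ext; simp [ofMatrix_apply]
  map_add' a b := by ext; simp [ofMatrix_apply]
  map_mul' a b := by
    ext
    simp [ofMatrix_apply, mul_apply, β.act_mul, U.comul_coeff]
  map_star' a := by
    ext
    simp [ofMatrix_apply, star_apply, β.act_star, U.star_antipode_coeff]

theorem norm_act_coeff_le {ι : Type*} [Fintype ι] (U : UnitaryCorep O ι) (i j : ι) (a : A) :
    ‖β.act (U.coeff i j) a‖ ≤ ‖a‖ :=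
  (CStarMatrix.norm_entry_le_norm (M := β.matrixHom U a) (i := i) (j := j)).trans
    (NonUnitalStarAlgHom.norm_apply_le (β.matrixHom U) a)

variable [StarModule ℂ O] [CompactQuantumGroup O]

theorem continuous_act (x : O) : Continuous (β.act x) := by
  obtain ⟨n, U, hx⟩ := exists_unitaryCorep x
  induction hx using Submodule.span_induction with
  | mem y hy =>
    obtain ⟨p, rfl⟩ := hy
    exact AddMonoidHomClass.continuous_of_bound (β.act (U.coeff p.1 p.2)) 1 fun a => by
      simpa using β.norm_act_coeff_le U p.1 p.2 a
  | zero =>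
    rw [map_zero]
    exact continuous_const
  | add y z _ _ hy hz =>
    rw [map_add]
    exact hy.add hz
  | smul c y _ hy =>
    rw [map_smul]
    exact hy.const_smul c

end DualAction

section Equivariance

open scoped CStarAlgebra

variable {O : Type u} [Ring O] [StarRing O] [HopfAlgebra ℂ O] [StarModule ℂ O]
  [CompactQuantumGroup O] {A B C : Type u} [CStarAlgebra A] [CStarAlgebra B] [CStarAlgebra C]
  {X : YDStructure O A} {Y : YDStructure O B} {Z : YDStructure O C}

namespace IsEquivariant

theorem id : IsEquivariant X X LinearMap.id where
  coact a t h := by simpa only [LinearMap.lTensor_id, LinearMap.id_apply] using h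
  act _ _ := rfl

theorem comp {ψ : B →ₗ[ℂ] C} {φ : A →ₗ[ℂ] B} (hψ : IsEquivariant Y Z ψ)
    (hφ : IsEquivariant X Y φ) : IsEquivariant X Z (ψ ∘ₗ φ) where
  coact a t h := by
    rw [LinearMap.lTensor_comp]
    exact hψ.coact _ _ (hφ.coact a t h)
  act x a := by simp [hφ.act, hψ.act]

theorem add {φ ψ : A →ₗ[ℂ] B} (hφ : IsEquivariant X Y φ) (hψ : IsEquivariant X Y ψ) :
    IsEquivariant X Y (φ + ψ) where
  coact a t h := by simp [hφ.coact a t h, hψ.coact a t h]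
  act x a := by simp [hφ.act, hψ.act]

theorem smul {φ : A →ₗ[ℂ] B} (hφ : IsEquivariant X Y φ) (c : ℂ) : IsEquivariant X Y (c • φ) where
  coact a t h := by simp [hφ.coact a t h]
  act x a := by simp [hφ.act]

theorem of_starAlgHom (φ : A →⋆ₐ[ℂ] B)
    (h_coact : ∀ a, Y.coact (φ a) = MinTensor.mapRight (ReducedCStar O) φ (X.coact a))
    (h_act : ∀ x a, φ (X.act x a) = Y.act x (φ a)) :
    IsEquivariant X Y φ.toAlgHom.toLinearMap where
  coact a t h := by
    rw [← mapRight_regularEmb, ← h]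
    exact h_coact a
  act := h_act

theorem coact_apply {φ : A →⋆ₐ[ℂ] B} (h : IsEquivariant X Y φ.toAlgHom.toLinearMap) (a : A) :
    Y.coact (φ a) = MinTensor.mapRight (ReducedCStar O) φ (X.coact a) := by
  have h_closed : IsClosed {a | Y.coact (φ a) =
      MinTensor.mapRight (ReducedCStar O) φ (X.coact a)} :=
    isClosed_eq ((map_continuous Y.coact).comp (map_continuous φ))
      ((map_continuous (MinTensor.mapRight _ φ)).comp (map_continuous X.coact))
  refine h_closed.closure_subset_iff.2 ?_ (X.dense_regular a)
  rintro a ⟨t, ht⟩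
  rw [Set.mem_ofPred_eq, ht, mapRight_regularEmb]
  exact h.coact a t ht

theorem of_comp_injective {ψ : B →⋆ₐ[ℂ] C} (hi : Function.Injective ψ)
    (hψ : IsEquivariant Y Z ψ.toAlgHom.toLinearMap) {φ : A →ₗ[ℂ] B}
    (h : IsEquivariant X Z (ψ.toAlgHom.toLinearMap ∘ₗ φ)) : IsEquivariant X Y φ where
  coact a t hat := by
    refine MinTensor.mapRight_injective (C := ReducedCStar O) hi ?_
    rw [mapRight_regularEmb, ← hψ.coact_apply, ← LinearMap.comp_apply, ← LinearMap.lTensor_comp]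
    exact h.coact a t hat
  act x a := hi ((h.act x a).trans (hψ.act x (φ a)).symm)

end IsEquivariant

end Equivariance

section Rigidity

variable {O : Type u} [Ring O] [StarRing O] [HopfAlgebra ℂ O] [StarModule ℂ O]
  [CompactQuantumGroup O] {A B C : YDAlgebra O}

theorem convex_setOf_isEquivariantUCP : Convex ℝ {φ : A →ₗ[ℂ] B | IsEquivariantUCP A B φ} :=
  fun _ hφ _ hψ s t hs ht hst =>
    ⟨convex_setOf_isUCP hφ.1 hψ.1 hs ht hst, (hφ.2.smul (s : ℂ)).add (hψ.2.smul (t : ℂ))⟩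

namespace IsEquivariantUCP

theorem id : IsEquivariantUCP A A LinearMap.id :=
  ⟨IsUCP.of_starAlgHom (StarAlgHom.id ℂ A), IsEquivariant.id⟩

theorem comp {ψ : B →ₗ[ℂ] C} {φ : A →ₗ[ℂ] B} (hψ : IsEquivariantUCP B C ψ)
    (hφ : IsEquivariantUCP A B φ) : IsEquivariantUCP A C (ψ ∘ₗ φ) :=
  ⟨hψ.1.comp hφ.1, hψ.2.comp hφ.2⟩

theorem pow {φ : A →ₗ[ℂ] A} (hφ : IsEquivariantUCP A A φ) (n : ℕ) :
    IsEquivariantUCP A A (φ ^ n) := by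
  induction n with
  | zero => exact id
  | succ n ih => rw [pow_succ']; exact hφ.comp ih

theorem cesaro_mean {φ : A →ₗ[ℂ] A} (hφ : IsEquivariantUCP A A φ) {n : ℕ} (hn : n ≠ 0) :
    IsEquivariantUCP A A (∑ k ∈ Finset.range n, (n : ℝ)⁻¹ • φ ^ k) :=
  convex_setOf_isEquivariantUCP.sum_mem (w := fun _ => (n : ℝ)⁻¹) (z := fun k => φ ^ k)
    (fun _ _ => by positivity) (by simp [hn]) fun k _ => hφ.pow k

end IsEquivariantUCP

/-- The Cesàro mean `ψ` of `1, φ, …, φⁿ⁻¹` is isometric, while `ψ(x - φ(x)) = (x - φⁿ(x)) / n`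
tends to zero. -/
theorem IsBoundary.eq_id (hA : IsBoundary A) {φ : A →ₗ[ℂ] A} (hφ : IsEquivariantUCP A A φ) :
    φ = LinearMap.id := by
  ext x
  rw [LinearMap.id_apply, eq_comm, ← sub_eq_zero]
  have h_bound (n : ℕ) : n • ‖x - φ x‖ ≤ 2 * ‖x‖ := by
    rcases eq_or_ne n 0 with rfl | hn
    · simp
    have h_telescope : n • (∑ k ∈ Finset.range n, (n : ℝ)⁻¹ • φ ^ k) (x - φ x) =
        x - (φ ^ n) x := by
      have h := LinearMap.congr_fun (geom_sum_mul_neg φ n) x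
      rw [← Finset.smul_sum, LinearMap.smul_apply, ← Nat.cast_smul_eq_nsmul ℝ,
        smul_inv_smul₀ (Nat.cast_ne_zero.2 hn)]
      simpa using h
    have h_norm := congrArg norm h_telescope
    rw [RCLike.norm_nsmul (K := ℝ), (hA A _ (hφ.cesaro_mean hn)).norm_map] at h_norm
    linarith [norm_sub_le x ((φ ^ n) x), (hφ.pow n).1.norm_le x]
  by_contra h_ne
  obtain ⟨n, hn⟩ := Archimedean.arch (2 * ‖x‖ + 1) (norm_pos_iff.2 h_ne)
  linarith [h_bound n]

end Rigidity

section Lift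

variable {A B C : Type*} [CStarAlgebra A] [CStarAlgebra B] [CStarAlgebra C]

/-- The factorization of a `⋆`-homomorphism `f` through an injective one whose range contains the
range of `f`. -/
def starAlgHomLift (f : A →⋆ₐ[ℂ] B) {j : C →⋆ₐ[ℂ] B} (hj : Function.Injective j)
    (h : ∀ a, f a ∈ j.range) : A →⋆ₐ[ℂ] C :=
  ((StarAlgEquiv.ofInjective j hj).symm : j.range →⋆ₐ[ℂ] C).comp (f.codRestrict j.range h)

theorem apply_starAlgHomLift (f : A →⋆ₐ[ℂ] B) {j : C →⋆ₐ[ℂ] B} (hj : Function.Injective j)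
    (h : ∀ a, f a ∈ j.range) (a : A) : j (starAlgHomLift f hj h a) = f a :=
  congrArg Subtype.val
    ((StarAlgEquiv.ofInjective j hj).apply_symm_apply (f.codRestrict j.range h a))

end Lift

theorem assoc_rTensor_comul_lTensor {k O M N : Type*} [CommSemiring k] [AddCommMonoid O]
    [Module k O] [Coalgebra k O] [AddCommMonoid M] [Module k M] [AddCommMonoid N] [Module k N]
    (f : M →ₗ[k] N) (t : O ⊗[k] M) :
    TensorProduct.assoc k O O N ((Coalgebra.comul (R := k)).rTensor N (f.lTensor O t)) =
      (f.lTensor O).lTensor O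
        (TensorProduct.assoc k O O M ((Coalgebra.comul (R := k)).rTensor M t)) := by
  rw [← LinearMap.comp_apply (LinearMap.rTensor N _), LinearMap.rTensor_comp_lTensor,
    ← LinearMap.lTensor_comp_rTensor, LinearMap.comp_apply, LinearMap.lTensor_tensor]
  simp

section Restriction

variable {O : Type u} [Ring O] [StarRing O] [HopfAlgebra ℂ O] {A : Type u} [CStarAlgebra A]

namespace DualAction

variable (β : DualAction O A) (S : StarSubalgebra ℂ A)

/-- The restriction of the module structure of a dual action to an invariant subalgebra. -/
def restrictAct (h : ∀ x, ∀ s ∈ S, β.act x s ∈ S) : O →ₐ[ℂ] Module.End ℂ S :=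
  AlgHom.ofLinearMap
    { toFun x :=
        { toFun s := ⟨β.act x s, h x s s.2⟩
          map_add' s t := Subtype.ext (map_add (β.act x) (s : A) t)
          map_smul' c s := Subtype.ext (map_smul (β.act x) c (s : A)) }
      map_add' x y := by ext; simp
      map_smul' c x := by ext; simp }
    (by ext; simp) (fun x y => by ext; simp)

variable [IsClosed (S : Set A)]

/-- The restriction of a dual action to an invariant subalgebra. -/
def restrict (h : ∀ x, ∀ s ∈ S, β.act x s ∈ S) : DualAction O S where
  act := β.restrictAct S h
  act_mul x a b := by
    have h_coe (t : O ⊗[ℂ] O) :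
        S.subtype.toAlgHom.toLinearMap (LinearMap.mul' ℂ S
          (TensorProduct.map ((β.restrictAct S h).toLinearMap.flip a)
            ((β.restrictAct S h).toLinearMap.flip b) t)) =
        LinearMap.mul' ℂ A (TensorProduct.map (β.act.toLinearMap.flip (a : A))
          (β.act.toLinearMap.flip (b : A)) t) := by
      induction t with
      | zero => simp
      | add s t hs ht => simp only [map_add, ← hs, ← ht]
      | tmul y z => rfl
    exact Subtype.ext ((β.act_mul x a b).trans (h_coe _).symm)
  act_one x := Subtype.ext (β.act_one x)
  act_star x a := Subtype.ext (β.act_star x a)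

variable [StarModule ℂ O] [CompactQuantumGroup O]

theorem lTensor_restrict_twist (h : ∀ x, ∀ s ∈ S, β.act x s ∈ S) (w : O ⊗[ℂ] (O ⊗[ℂ] O))
    (t : O ⊗[ℂ] S) : S.subtype.toAlgHom.toLinearMap.lTensor O ((β.restrict S h).twist w t) =
      β.twist w (S.subtype.toAlgHom.toLinearMap.lTensor O t) := by
  induction w with
  | zero => simp
  | add w w' hw hw' => simp only [map_add, LinearMap.add_apply, hw, hw']
  | tmul x w =>
    induction w with
    | zero => simp
    | add w w' hw hw' => simp only [TensorProduct.tmul_add, map_add, LinearMap.add_apply, hw, hw']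
    | tmul y z =>
      induction t with
      | zero => simp
      | add t t' ht ht' => simp only [map_add, ht, ht']
      | tmul v s =>
        rw [twist_tmul, LinearMap.lTensor_tmul, LinearMap.lTensor_tmul, twist_tmul]
        rfl

end DualAction

variable [StarModule ℂ O] [CompactQuantumGroup O]

namespace YDStructure

open scoped CStarAlgebra

/-- Subalgebras to which both actions restrict. The restricted action of `G` exists as soon as there
is a dense set of elements which are regular for the subalgebra. -/
structure IsInvariant (X : YDStructure O A) (S : StarSubalgebra ℂ A) : Prop where
  act_mem : ∀ x, ∀ s ∈ S, X.act x s ∈ S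
  dense_regular : Dense {s : S | ∃ t : O ⊗[ℂ] S,
    X.coact s = regularEmb O A (S.subtype.toAlgHom.toLinearMap.lTensor O t)}

variable {X : YDStructure O A} {S : StarSubalgebra ℂ A} [IsClosed (S : Set A)]

theorem mapRight_subtype_injective :
    Function.Injective (MinTensor.mapRight (ReducedCStar O) S.subtype) :=
  MinTensor.mapRight_injective Subtype.val_injective

namespace IsInvariant

theorem coact_mem_range (h : X.IsInvariant S) (s : S) :
    X.coact s ∈ (MinTensor.mapRight (ReducedCStar O) S.subtype).range := by
  have h_closed : IsClosed {s : S |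
      X.coact s ∈ Set.range (MinTensor.mapRight (ReducedCStar O) S.subtype)} :=
    (NonUnitalStarAlgHom.isometry (MinTensor.mapRight (ReducedCStar O) S.subtype)
      mapRight_subtype_injective).isClosedEmbedding.isClosed_range.preimage
        ((map_continuous X.coact).comp continuous_subtype_val)
  refine h_closed.closure_subset_iff.2 ?_ (h.dense_regular s)
  rintro s ⟨t, ht⟩
  exact ⟨regularEmb O S t, (mapRight_regularEmb S.subtype t).trans ht.symm⟩

/-- The restriction of the action of `G`. -/
def coactRestrict (h : X.IsInvariant S) : S →⋆ₐ[ℂ] MinTensor (ReducedCStar O) S :=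
  starAlgHomLift (X.coact.comp S.subtype) mapRight_subtype_injective h.coact_mem_range

theorem mapRight_coactRestrict (h : X.IsInvariant S) (s : S) :
    MinTensor.mapRight (ReducedCStar O) S.subtype (h.coactRestrict s) = X.coact s :=
  apply_starAlgHomLift (X.coact.comp S.subtype) mapRight_subtype_injective h.coact_mem_range s

theorem coactRestrict_eq_regularEmb_iff (h : X.IsInvariant S) {s : S} {t : O ⊗[ℂ] S} :
    h.coactRestrict s = regularEmb O S t ↔
      X.coact s = regularEmb O A (S.subtype.toAlgHom.toLinearMap.lTensor O t) := by
  rw [← mapRight_subtype_injective.eq_iff, mapRight_coactRestrict, mapRight_regularEmb]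

theorem coassoc_coactRestrict (h : X.IsInvariant S) (s : S) (t : O ⊗[ℂ] S)
    (hst : h.coactRestrict s = regularEmb O S t) :
    (regularEmb O S).toLinearMap.lTensor O
        (TensorProduct.assoc ℂ O O S ((Coalgebra.comul (R := ℂ)).rTensor S t)) =
      h.coactRestrict.toAlgHom.toLinearMap.lTensor O t := by
  let J := (MinTensor.mapRight (ReducedCStar O) S.subtype).toAlgHom.toLinearMap
  have h_coact : J ∘ₗ h.coactRestrict.toAlgHom.toLinearMap =
      X.coact.toAlgHom.toLinearMap ∘ₗ S.subtype.toAlgHom.toLinearMap :=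
    LinearMap.ext h.mapRight_coactRestrict
  have h_emb : J ∘ₗ (regularEmb O S).toLinearMap =
      (regularEmb O A).toLinearMap ∘ₗ S.subtype.toAlgHom.toLinearMap.lTensor O :=
    LinearMap.ext (mapRight_regularEmb S.subtype)
  refine Module.Flat.lTensor_preserves_injective_linearMap (M := O) J
    mapRight_subtype_injective ?_
  calc J.lTensor O ((regularEmb O S).toLinearMap.lTensor O
        (TensorProduct.assoc ℂ O O S ((Coalgebra.comul (R := ℂ)).rTensor S t)))
    _ = (regularEmb O A).toLinearMap.lTensor O
        (TensorProduct.assoc ℂ O O A ((Coalgebra.comul (R := ℂ)).rTensor A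
          (S.subtype.toAlgHom.toLinearMap.lTensor O t))) := by
      rw [assoc_rTensor_comul_lTensor, ← LinearMap.lTensor_comp_apply, h_emb,
        LinearMap.lTensor_comp_apply]
    _ = X.coact.toAlgHom.toLinearMap.lTensor O (S.subtype.toAlgHom.toLinearMap.lTensor O t) :=
      X.coassoc s _ (h.coactRestrict_eq_regularEmb_iff.1 hst)
    _ = (X.coact.toAlgHom.toLinearMap ∘ₗ S.subtype.toAlgHom.toLinearMap).lTensor O t :=
      (LinearMap.lTensor_comp_apply O _ _ t).symm
    _ = (J ∘ₗ h.coactRestrict.toAlgHom.toLinearMap).lTensor O t :=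
      congrArg (fun f => f.lTensor O t) h_coact.symm
    _ = J.lTensor O (h.coactRestrict.toAlgHom.toLinearMap.lTensor O t) :=
      LinearMap.lTensor_comp_apply O _ _ t

/-- The restriction of a Yetter–Drinfeld structure to an invariant subalgebra. -/
def restrict (h : X.IsInvariant S) : YDStructure O S where
  toDualAction := X.toDualAction.restrict S h.act_mem
  coact := h.coactRestrict
  coact_injective s s' hs := Subtype.ext <| X.coact_injective <| by
    rw [← h.mapRight_coactRestrict, ← h.mapRight_coactRestrict, hs]
  dense_regular := by
    simpa only [h.coactRestrict_eq_regularEmb_iff] using h.dense_regular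
  coassoc := h.coassoc_coactRestrict
  yetterDrinfeld x s t hst := by
    refine h.coactRestrict_eq_regularEmb_iff.2 ?_
    rw [DualAction.lTensor_restrict_twist]
    exact X.yetterDrinfeld x s _ (h.coactRestrict_eq_regularEmb_iff.1 hst)

theorem isEquivariant_subtype (h : X.IsInvariant S) :
    IsEquivariant h.restrict X S.subtype.toAlgHom.toLinearMap :=
  IsEquivariant.of_starAlgHom S.subtype (fun s => (h.mapRight_coactRestrict s).symm) fun _ _ => rfl

end IsInvariant

end YDStructure

/-- The Yetter–Drinfeld subalgebra defined by a closed invariant subalgebra. -/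
def YDSubalgebra.ofInvariant {F : YDAlgebra O} {S : StarSubalgebra ℂ F} (hS : IsClosed (S : Set F))
    (h : F.str.IsInvariant S) : YDSubalgebra F where
  toStarSubalgebra := S
  isClosed := hS
  str := h.restrict
  equivariant := h.isEquivariant_subtype

end Restriction

section InjectiveBoundary

variable {O : Type u} [Ring O] [StarRing O] [HopfAlgebra ℂ O]

theorem DualAction.act_algebraMap {A : Type u} [CStarAlgebra A] (β : DualAction O A) (x : O)
    (c : ℂ) : β.act x (algebraMap ℂ A c) = algebraMap ℂ A (c * Coalgebra.counit (R := ℂ) x) := by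
  rw [Algebra.algebraMap_eq_smul_one, map_smul, β.act_one, smul_smul,
    Algebra.algebraMap_eq_smul_one]

variable [StarModule ℂ O] [CompactQuantumGroup O]

theorem regularEmb_one_tmul_algebraMap {A : Type u} [CStarAlgebra A] (c : ℂ) :
    regularEmb O A (1 ⊗ₜ algebraMap ℂ A c) = algebraMap ℂ _ c := by
  rw [← AlgHomClass.commutes (regularEmb O A) c, Algebra.algebraMap_eq_smul_one,
    TensorProduct.tmul_smul, Algebra.algebraMap_eq_smul_one, Algebra.TensorProduct.one_def]

variable {F : YDAlgebra O}

namespace YDSubalgebra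

/-- The inclusion of a Yetter–Drinfeld subalgebra, as a `⋆`-homomorphism. -/
def incl (S : YDSubalgebra F) : S.toYDAlgebra →⋆ₐ[ℂ] F :=
  S.toStarSubalgebra.subtype

theorem incl_injective (S : YDSubalgebra F) : Function.Injective S.incl :=
  Subtype.val_injective

theorem isEquivariantUCP_incl (S : YDSubalgebra F) :
    IsEquivariantUCP S.toYDAlgebra F S.incl.toAlgHom.toLinearMap :=
  ⟨IsUCP.of_starAlgHom S.incl, S.equivariant⟩

theorem isCompletelyIsometric_incl (S : YDSubalgebra F) :
    IsCompletelyIsometric S.incl.toAlgHom.toLinearMap :=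
  IsCompletelyIsometric.of_starAlgHom S.incl S.incl_injective

theorem isEquivariantUCP_inclusion {S T : YDSubalgebra F}
    (h : S.toStarSubalgebra ≤ T.toStarSubalgebra) :
    IsEquivariantUCP S.toYDAlgebra T.toYDAlgebra (inclusion h) :=
  let i : S.toYDAlgebra →⋆ₐ[ℂ] T.toYDAlgebra := StarSubalgebra.inclusion h
  ⟨IsUCP.of_starAlgHom i, IsEquivariant.of_comp_injective T.incl_injective
    T.isEquivariantUCP_incl.2 S.isEquivariantUCP_incl.2⟩

theorem isInvariant_scalars : F.str.IsInvariant (StarAlgHom.ofId ℂ F).range where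
  act_mem := by
    rintro x _ ⟨c, rfl⟩
    exact ⟨_, (F.str.act_algebraMap x c).symm⟩
  dense_regular := by
    refine dense_iff_closure_eq.2 (Set.eq_univ_of_forall fun s => subset_closure ?_)
    obtain ⟨_, c, rfl⟩ := s
    refine ⟨1 ⊗ₜ algebraMap ℂ _ c, ?_⟩
    exact (AlgHomClass.commutes F.str.coact c).trans (regularEmb_one_tmul_algebraMap c).symm

variable (F) in
/-- The Yetter–Drinfeld subalgebra `ℂ1` of `F`. -/
def scalars : YDSubalgebra F :=
  ofInvariant (algebraMap_isometry ℂ F).isClosedEmbedding.isClosed_range isInvariant_scalars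

theorem exists_map_of_scalars (B : YDAlgebra O) : ∃ φ : (scalars F).toYDAlgebra →ₗ[ℂ] B,
    IsEquivariantUCP (scalars F).toYDAlgebra B φ ∧ IsCompletelyIsometric φ := by
  let e := StarAlgEquiv.ofInjective (StarAlgHom.ofId ℂ F) (algebraMap_isometry ℂ F).injective
  let φ : (scalars F).toYDAlgebra →⋆ₐ[ℂ] B :=
    (StarAlgHom.ofId ℂ B).comp (e.symm : (StarAlgHom.ofId ℂ F).range →⋆ₐ[ℂ] ℂ)
  have h_inj : Function.Injective φ := (algebraMap_isometry ℂ B).injective.comp e.symm.injective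
  have h_scalar : ∀ s : (scalars F).toYDAlgebra, ∃ c, s = algebraMap ℂ _ c := by
    rintro ⟨_, c, rfl⟩
    exact ⟨c, rfl⟩
  refine ⟨φ.toAlgHom.toLinearMap, ⟨IsUCP.of_starAlgHom φ,
    IsEquivariant.of_starAlgHom φ (fun s => ?_) fun x s => ?_⟩,
    IsCompletelyIsometric.of_starAlgHom φ h_inj⟩
  · obtain ⟨c, rfl⟩ := h_scalar s
    rw [AlgHomClass.commutes, AlgHomClass.commutes, AlgHomClass.commutes, AlgHomClass.commutes]
  · obtain ⟨c, rfl⟩ := h_scalar s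
    rw [DualAction.act_algebraMap, AlgHomClass.commutes, AlgHomClass.commutes,
      DualAction.act_algebraMap]

end YDSubalgebra

theorem IsDGInjective.exists_map (hF : IsDGInjective F) (B : YDAlgebra O) :
    ∃ ψ : B →ₗ[ℂ] F, IsEquivariantUCP B F ψ := by
  obtain ⟨φ, hφ, hi⟩ := YDSubalgebra.exists_map_of_scalars (F := F) B
  obtain ⟨ψ, hψ, -⟩ := hF _ _ φ _ hφ hi (YDSubalgebra.scalars F).isEquivariantUCP_incl
  exact ⟨ψ, hψ⟩

namespace IsFurstenbergHamanaBoundary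

theorem eq_incl (hF : IsFurstenbergHamanaBoundary F) (S : YDSubalgebra F)
    {χ : S.toYDAlgebra →ₗ[ℂ] F} (hχ : IsEquivariantUCP S.toYDAlgebra F χ) :
    χ = S.incl.toAlgHom.toLinearMap := by
  obtain ⟨χ', hχ', h⟩ := hF.2 _ _ _ χ S.isEquivariantUCP_incl S.isCompletelyIsometric_incl hχ
  rw [← h, hF.1.eq_id hχ', LinearMap.id_comp]

theorem coe_apply (hF : IsFurstenbergHamanaBoundary F) {S T : YDSubalgebra F}
    {φ : S.toYDAlgebra →ₗ[ℂ] T.toYDAlgebra}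
    (hφ : IsEquivariantUCP S.toYDAlgebra T.toYDAlgebra φ) (s : S.toYDAlgebra) :
    T.incl (φ s) = S.incl s :=
  LinearMap.congr_fun (hF.eq_incl S (T.isEquivariantUCP_incl.comp hφ)) s

theorem isBoundary_subalgebra (hF : IsFurstenbergHamanaBoundary F) (S : YDSubalgebra F) :
    IsBoundary S.toYDAlgebra := by
  intro B χ hχ
  obtain ⟨θ, hθ⟩ := hF.2.exists_map B
  refine IsCompletelyIsometric.of_comp hθ.1 hχ.1 ?_
  rw [hF.eq_incl S (hθ.comp hχ)]
  exact S.isCompletelyIsometric_incl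

end IsFurstenbergHamanaBoundary

theorem IsEquivariant.symm {A B : YDAlgebra O} {e : A ≃⋆ₐ[ℂ] B}
    (h : IsEquivariant A.str B.str (e : A →⋆ₐ[ℂ] B).toAlgHom.toLinearMap) :
    IsEquivariant B.str A.str (e.symm : B →⋆ₐ[ℂ] A).toAlgHom.toLinearMap := by
  refine of_comp_injective (ψ := (e : A →⋆ₐ[ℂ] B)) e.injective h ?_
  have h_id : (e : A →⋆ₐ[ℂ] B).toAlgHom.toLinearMap ∘ₗ
      (e.symm : B →⋆ₐ[ℂ] A).toAlgHom.toLinearMap = LinearMap.id :=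
    LinearMap.ext e.apply_symm_apply
  rw [h_id]
  exact IsEquivariant.id

theorem IsBoundary.of_isIsomorphic {A B : YDAlgebra O} (h : A.IsIsomorphic B)
    (hB : IsBoundary B) : IsBoundary A := by
  obtain ⟨e, he⟩ := h
  intro C ψ hψ n M
  have h_symm : IsEquivariantUCP B A (e.symm : B →⋆ₐ[ℂ] A).toAlgHom.toLinearMap :=
    ⟨IsUCP.of_starAlgHom _, IsEquivariant.symm he⟩
  have h_map : M.map ψ =
      (M.map e).map (ψ ∘ₗ (e.symm : B →⋆ₐ[ℂ] A).toAlgHom.toLinearMap) := by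
    ext k l
    exact congrArg ψ (e.symm_apply_apply (M k l)).symm
  rw [h_map, hB C _ (hψ.comp h_symm)]
  exact IsCompletelyIsometric.of_starAlgHom (e : A →⋆ₐ[ℂ] B) e.injective n M

end InjectiveBoundary

section Generated

variable {A B : Type u} [CStarAlgebra A] [CStarAlgebra B] {ψ : A →ₗ[ℂ] B}

/-- The C⋆-algebra generated by the image of a linear map. -/
abbrev generated (ψ : A →ₗ[ℂ] B) : StarSubalgebra ℂ B :=
  (StarAlgebra.adjoin ℂ (Set.range ψ)).topologicalClosure

instance isClosed_generated : IsClosed (generated ψ : Set B) :=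
  StarSubalgebra.isClosed_topologicalClosure _

/-- A linear map, viewed as a map into the C⋆-algebra generated by its image. -/
def toGenerated (ψ : A →ₗ[ℂ] B) : A →ₗ[ℂ] generated ψ :=
  ψ.codRestrict (generated ψ).toSubalgebra.toSubmodule fun a =>
    StarSubalgebra.le_topologicalClosure _ (StarAlgebra.subset_adjoin ℂ _ ⟨a, rfl⟩)

theorem generated_le {S : StarSubalgebra ℂ B} (hS : IsClosed (S : Set B)) (h : ∀ a, ψ a ∈ S) :
    generated ψ ≤ S :=
  StarSubalgebra.topologicalClosure_minimal
    (StarAlgebra.adjoin_le (Set.range_subset_iff.2 h)) hS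

theorem mem_of_toGenerated_mem {T : StarSubalgebra ℂ (generated ψ)}
    (hT : IsClosed (T : Set (generated ψ))) (h : ∀ a, toGenerated ψ a ∈ T) (s : generated ψ) :
    s ∈ T := by
  have h_closed : IsClosed (T.map (generated ψ).subtype : Set B) :=
    isClosed_generated.isClosedEmbedding_subtypeVal.isClosedMap _ hT
  obtain ⟨s', hs', h_eq⟩ := generated_le h_closed (fun a => ⟨toGenerated ψ a, h a, rfl⟩) s.2
  exact Subtype.ext h_eq ▸ hs'

end Generated

section LeftInverse

open scoped CStarAlgebra

variable {A B : Type u} [CStarAlgebra A] [CStarAlgebra B]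

/-- The pairs `(a, b)` for which `V` intertwines `σ(a)` with `τ(b)` and `σ(a⋆)` with `τ(b⋆)`. -/
def HilbertRep.intertwinedPairs {σ : HilbertRep A} {τ : HilbertRep B}
    (V : σ.space →ₗᵢ[ℂ] τ.space) : StarSubalgebra ℂ (A × B) where
  carrier := {d | ∀ k, τ.hom d.2 (V k) = V (σ.hom d.1 k) ∧
    τ.hom (star d.2) (V k) = V (σ.hom (star d.1) k)}
  mul_mem' {d e} hd he k := by
    simp [(hd _).1, (he _).1, (hd _).2, (he _).2]
  add_mem' {d e} hd he k := by
    simp [(hd _).1, (he _).1, (hd _).2, (he _).2]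
  algebraMap_mem' c k := by
    simp [Algebra.algebraMap_eq_smul_one]
  star_mem' {d} hd k := by
    simpa using (hd k).symm

theorem HilbertRep.isClosed_intertwinedPairs {σ : HilbertRep A} {τ : HilbertRep B}
    (V : σ.space →ₗᵢ[ℂ] τ.space) : IsClosed (intertwinedPairs V : Set (A × B)) := by
  have hσ := map_continuous σ.hom
  have hτ := map_continuous τ.hom
  simp only [intertwinedPairs, StarSubalgebra.coe_mk, Set.ofPred_forall, Set.ofPred_and]
  refine isClosed_iInter fun k => (isClosed_eq ?_ ?_).inter (isClosed_eq ?_ ?_) <;> fun_prop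

/-- The C⋆-algebra generated by the graph of `ψ` is itself a graph over the second coordinate: every
representation of `A` extends along `ψ`, and the second coordinate determines the extension. -/
theorem IsCompletelyIsometric.snd_injective_of_graph {ψ : A →ₗ[ℂ] B} (hψ : IsUCP ψ)
    (hi : IsCompletelyIsometric ψ) : Function.Injective
      ((StarAlgHom.snd ℂ A B).comp (generated (LinearMap.id.prod ψ)).subtype) := by
  refine (injective_iff_map_eq_zero _).2 fun d hd => Subtype.ext (Prod.ext ?_ hd)
  refine HilbertRep.eq_zero_of_forall fun σ => ?_
  obtain ⟨τ, V, hV⟩ := σ.exists_extension hψ hi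
  have h_le : generated (LinearMap.id.prod ψ) ≤ HilbertRep.intertwinedPairs V :=
    generated_le (HilbertRep.isClosed_intertwinedPairs V) fun a k =>
      ⟨hV a k, by simpa [hψ.map_star] using hV (star a) k⟩
  ext k
  refine V.injective ((h_le d.2 k).1.symm.trans ?_)
  change τ.hom ((StarAlgHom.snd ℂ A B).comp (generated (LinearMap.id.prod ψ)).subtype d) (V k) = _
  simp [hd]

theorem IsCompletelyIsometric.exists_leftInverse {ψ : A →ₗ[ℂ] B} (hψ : IsUCP ψ)
    (hi : IsCompletelyIsometric ψ) :
    ∃ π : generated ψ →⋆ₐ[ℂ] A, ∀ a, π (toGenerated ψ a) = a := by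
  let Γ : A →ₗ[ℂ] A × B := LinearMap.id.prod ψ
  let p : generated Γ →⋆ₐ[ℂ] A := (StarAlgHom.fst ℂ A B).comp (generated Γ).subtype
  let q : generated Γ →⋆ₐ[ℂ] B := (StarAlgHom.snd ℂ A B).comp (generated Γ).subtype
  have hq : Function.Injective q := snd_injective_of_graph hψ hi
  have h_le : generated ψ ≤ q.range :=
    generated_le (NonUnitalStarAlgHom.isometry q hq).isClosedEmbedding.isClosed_range fun a =>
      ⟨toGenerated Γ a, rfl⟩
  let g := starAlgHomLift (generated ψ).subtype hq fun s => h_le s.2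
  refine ⟨p.comp g, fun a => ?_⟩
  have hg : g (toGenerated ψ a) = toGenerated Γ a :=
    hq (apply_starAlgHomLift (generated ψ).subtype hq (fun s => h_le s.2) _)
  exact congrArg p hg

end LeftInverse

section GeneratedInvariance

open scoped CStarAlgebra

variable {O : Type u} [Ring O] [StarRing O] [HopfAlgebra ℂ O] {A B : Type u} [CStarAlgebra A]
  [CStarAlgebra B]

namespace DualAction

/-- The elements all of whose translates under a dual action lie in `S`. -/
def translatesMem (β : DualAction O B) (S : StarSubalgebra ℂ B) : StarSubalgebra ℂ B where
  carrier := {b | ∀ x, β.act x b ∈ S}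
  mul_mem' {b c} hb hc x := by
    rw [β.act_mul]
    generalize Coalgebra.comul (R := ℂ) x = t
    induction t with
    | zero => simp
    | add s t hs ht => simpa only [map_add] using add_mem hs ht
    | tmul y z => exact mul_mem (hb y) (hc z)
  add_mem' {b c} hb hc x := by
    rw [map_add]
    exact add_mem (hb x) (hc x)
  algebraMap_mem' c x := by
    rw [β.act_algebraMap]
    exact algebraMap_mem S _
  star_mem' {b} hb x := by
    rw [β.act_star]
    exact star_mem (hb _)

/-- The elements on whose translates a `⋆`-homomorphism is equivariant for two dual actions. -/
def equivariantLocus (β : DualAction O B) (γ : DualAction O A) (π : B →⋆ₐ[ℂ] A) :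
    StarSubalgebra ℂ B where
  carrier := {b | ∀ x, π (β.act x b) = γ.act x (π b)}
  mul_mem' {b c} hb hc x := by
    rw [map_mul π, β.act_mul, γ.act_mul]
    generalize Coalgebra.comul (R := ℂ) x = t
    induction t with
    | zero => simp
    | add s t hs ht => simp only [map_add, hs, ht]
    | tmul y z => simpa using congrArg₂ (· * ·) (hb y) (hc z)
  add_mem' {b c} hb hc x := by
    rw [map_add π, map_add, map_add, map_add, hb x, hc x]
  algebraMap_mem' c x := by
    rw [β.act_algebraMap, AlgHomClass.commutes, AlgHomClass.commutes, γ.act_algebraMap]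
  star_mem' {b} hb x := by
    rw [β.act_star, map_star π, map_star π, γ.act_star, hb]

variable [StarModule ℂ O] [CompactQuantumGroup O]

theorem isClosed_translatesMem (β : DualAction O B) {S : StarSubalgebra ℂ B}
    (hS : IsClosed (S : Set B)) : IsClosed (β.translatesMem S : Set B) := by
  simp only [translatesMem, StarSubalgebra.coe_mk, Set.ofPred_forall]
  exact isClosed_iInter fun x => hS.preimage (β.continuous_act x)

theorem isClosed_equivariantLocus (β : DualAction O B) (γ : DualAction O A) (π : B →⋆ₐ[ℂ] A) :
    IsClosed (β.equivariantLocus γ π : Set B) := by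
  simp only [equivariantLocus, StarSubalgebra.coe_mk, Set.ofPred_forall]
  exact isClosed_iInter fun x => isClosed_eq
    ((map_continuous π).comp (β.continuous_act x)) ((γ.continuous_act x).comp (map_continuous π))

end DualAction

variable [StarModule ℂ O] [CompactQuantumGroup O]

/-- The elements of `S` that are regular for the action of `G`, with second legs in `S`. -/
def YDStructure.regularSubalgebra (Y : YDStructure O B) (S : StarSubalgebra ℂ B)
    [IsClosed (S : Set B)] : StarSubalgebra ℂ S :=
  let emb : O ⊗[ℂ] S →⋆ₐ[ℂ] MinTensor (ReducedCStar O) S :=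
    { toAlgHom := regularEmb O S
      map_star' := regularEmb_star }
  (((MinTensor.mapRight (ReducedCStar O) S.subtype).comp emb).range).comap (Y.coact.comp S.subtype)

theorem YDStructure.mem_regularSubalgebra {Y : YDStructure O B} {S : StarSubalgebra ℂ B}
    [IsClosed (S : Set B)] {s : S} : s ∈ Y.regularSubalgebra S ↔ ∃ t : O ⊗[ℂ] S,
      Y.coact s = regularEmb O B (S.subtype.toAlgHom.toLinearMap.lTensor O t) :=
  exists_congr fun t => by
    rw [← mapRight_regularEmb]
    exact eq_comm

variable {X : YDStructure O A} {Y : YDStructure O B} {ψ : A →ₗ[ℂ] B}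

theorem IsEquivariant.isInvariant_generated (hψ : IsEquivariant X Y ψ) (hc : Continuous ψ) :
    Y.IsInvariant (generated ψ) where
  act_mem := by
    have h_le : generated ψ ≤ Y.translatesMem (generated ψ) :=
      generated_le (Y.isClosed_translatesMem isClosed_generated) fun a x =>
        hψ.act x a ▸ (toGenerated ψ (X.act x a)).2
    exact fun x s hs => h_le hs x
  dense_regular := by
    have h_cont : Continuous (toGenerated ψ) := hc.subtype_mk _
    have h_mem (a : A) :
        toGenerated ψ a ∈ (Y.regularSubalgebra (generated ψ)).topologicalClosure := by
      refine map_mem_closure h_cont (X.dense_regular a) ?_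
      rintro a ⟨t, ht⟩
      refine YDStructure.mem_regularSubalgebra.2 ⟨(toGenerated ψ).lTensor O t, ?_⟩
      rw [← LinearMap.lTensor_comp_apply]
      exact hψ.coact a t ht
    intro s
    have h_closure := mem_of_toGenerated_mem (ψ := ψ)
      (StarSubalgebra.isClosed_topologicalClosure _) h_mem s
    exact closure_mono (fun s => YDStructure.mem_regularSubalgebra.1) h_closure

theorem IsEquivariant.isEquivariant_toGenerated (hψ : IsEquivariant X Y ψ)
    (h : Y.IsInvariant (generated ψ)) : IsEquivariant X h.restrict (toGenerated ψ) :=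
  of_comp_injective Subtype.val_injective h.isEquivariant_subtype hψ

/-- Both equivariance conditions define closed subalgebras, so they need only be checked on the
image of `ψ`. -/
theorem IsEquivariant.leftInverse {Z : YDStructure O (generated ψ)} (hc : Continuous ψ)
    (hψ : IsEquivariant X Z (toGenerated ψ)) {π : generated ψ →⋆ₐ[ℂ] A}
    (hπ : ∀ a, π (toGenerated ψ a) = a) :
    IsEquivariant Z X π.toAlgHom.toLinearMap := by
  let coactπ := X.coact.comp π
  let πcoact := (MinTensor.mapRight (ReducedCStar O) π).comp Z.coact
  have h_closed : IsClosed (StarAlgHom.equalizer coactπ πcoact : Set (generated ψ)) :=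
    isClosed_eq (map_continuous coactπ) (map_continuous πcoact)
  refine of_starAlgHom π (mem_of_toGenerated_mem h_closed fun a => ?_) fun x s => ?_
  · have h_cont : Continuous (toGenerated ψ) := hc.subtype_mk _
    refine (h_closed.preimage h_cont).closure_subset_iff.2 ?_ (X.dense_regular a)
    rintro a ⟨t, ht⟩
    have h_id : π.toAlgHom.toLinearMap ∘ₗ toGenerated ψ = LinearMap.id := LinearMap.ext hπ
    change X.coact (π (toGenerated ψ a)) =
      MinTensor.mapRight (ReducedCStar O) π (Z.coact (toGenerated ψ a))
    rw [hπ, hψ.coact a t ht, mapRight_regularEmb, ← LinearMap.lTensor_comp_apply, h_id,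
      LinearMap.lTensor_id, LinearMap.id_apply, ht]
  · refine mem_of_toGenerated_mem (Z.isClosed_equivariantLocus X.toDualAction π) (fun a y => ?_) s x
    rw [← hψ.act, hπ, hπ]

end GeneratedInvariance

section Embedding

variable {O : Type u} [Ring O] [StarRing O] [HopfAlgebra ℂ O] [StarModule ℂ O]
  [CompactQuantumGroup O] {A F : YDAlgebra O}

/-- The Yetter–Drinfeld subalgebra generated by the image of an equivariant ucp map. -/
def IsEquivariantUCP.generated {ψ : A →ₗ[ℂ] F} (hψ : IsEquivariantUCP A F ψ) : YDSubalgebra F :=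
  YDSubalgebra.ofInvariant isClosed_generated (hψ.2.isInvariant_generated hψ.1.continuous)

theorem IsFurstenbergHamanaBoundary.exists_isIsomorphic (hF : IsFurstenbergHamanaBoundary F)
    (hA : IsBoundary A) : ∃ S : YDSubalgebra F, A.IsIsomorphic S.toYDAlgebra := by
  obtain ⟨ψ, hψ⟩ := hF.2.exists_map A
  obtain ⟨π, hπ⟩ := (hA F ψ hψ).exists_leftInverse hψ.1
  let π : hψ.generated.toYDAlgebra →⋆ₐ[ℂ] A := π
  have h_equivariant : IsEquivariant hψ.generated.toYDAlgebra.str A.str π.toAlgHom.toLinearMap :=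
    .leftInverse hψ.1.continuous (hψ.2.isEquivariant_toGenerated _) hπ
  have h_isometric : IsCompletelyIsometric π.toAlgHom.toLinearMap :=
    hF.isBoundary_subalgebra hψ.generated A _ ⟨IsUCP.of_starAlgHom π, h_equivariant⟩
  have h_injective : Function.Injective π :=
    (AddMonoidHomClass.isometry_of_norm π h_isometric.norm_map).injective
  let e : hψ.generated.toYDAlgebra ≃⋆ₐ[ℂ] A :=
    StarAlgEquiv.ofBijective π ⟨h_injective, fun a => ⟨_, hπ a⟩⟩
  exact ⟨hψ.generated, e.symm, IsEquivariant.symm (e := e) h_equivariant⟩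

end Embedding

end

theorem theorem2p8 {O : Type u} [Ring O] [StarRing O] [HopfAlgebra ℂ O] [StarModule ℂ O]
    [CompactQuantumGroup O] (F : YDAlgebra O) (hF : IsFurstenbergHamanaBoundary F) :
    (∀ A : YDAlgebra O, IsBoundary A ↔ ∃ S : YDSubalgebra F, A.IsIsomorphic S.toYDAlgebra) ∧
    ∀ S₁ S₂ : YDSubalgebra F,
      (∀ (h : S₁.toStarSubalgebra ≤ S₂.toStarSubalgebra)
        (φ : S₁.toYDAlgebra →ₗ[ℂ] S₂.toYDAlgebra),
          IsEquivariantUCP S₁.toYDAlgebra S₂.toYDAlgebra φ ↔ φ = YDSubalgebra.inclusion h) ∧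
      (¬ S₁.toStarSubalgebra ≤ S₂.toStarSubalgebra →
        ¬ ∃ φ : S₁.toYDAlgebra →ₗ[ℂ] S₂.toYDAlgebra,
          IsEquivariantUCP S₁.toYDAlgebra S₂.toYDAlgebra φ) := by
  refine ⟨fun A => ⟨hF.exists_isIsomorphic, ?_⟩, fun S₁ S₂ => ⟨fun h φ => ⟨fun hφ => ?_, ?_⟩, ?_⟩⟩
  · rintro ⟨S, hS⟩
    exact IsBoundary.of_isIsomorphic hS (hF.isBoundary_subalgebra S)
  · exact LinearMap.ext fun s => S₂.incl_injective (hF.coe_apply hφ s)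
  · rintro rfl
    exact YDSubalgebra.isEquivariantUCP_inclusion h
  · rintro h ⟨φ, hφ⟩
    refine h fun s hs => ?_
    have h_eq : S₂.incl (φ ⟨s, hs⟩) = s := hF.coe_apply hφ ⟨s, hs⟩
    rw [← h_eq]
    exact (φ ⟨s, hs⟩).2
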